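/- Let $A$ and $G$ be (possibly unbounded) selfadjoint operators in a complex Hilbert space $(\mathcal H,(\cdot,\cdot))$, and let $AG$ and $GA$ denote their products on the natural domains. A real polynomial $p\neq 0$ of degree $d$ is called *definitizing* for $(A,G)$ if $(p(AG)x,Gx)\ge 0$ for all $x\in\operatorname{dom}(AG)^{\max\{1,d\}}$. The pair $(A,G)$ is called *definitizable* if the resolvent sets $\rho(AG)$ and $\rho(GA)$ are non-empty and a definitizing polynomial for $(A,G)$ exists. Suppose that $(A,G)$ is definitizable. (a) The non-real spectrum $\sigma(AG)\setminus\mathbb R$ is a finite set, each of its points is a pole of the resolvent of $AG$, and each of its points is a zero of every definitizing polynomial for $(A,G)$. Moreover, let $\lambda_0\in\rho(AG)\setminus\mathbb R$ be arbitrary. Then $\overline{\lambda_0}\in\rho(AG)$, the operator $G_0:=G(AG-\lambda_0)^{-1}(AG-\overline{\lambda_0})^{-1}$ is bounded, everywhere defined and selfadjoint, and with $[x,y]:=(G_0x,y)$ the operator $AG$ is closed, densely defined and satisfies $[AGx,y]=[x,AGy]$ for all $x,y\in\operatorname{dom}(AG)$. A point $\lambda\in\mathbb C$ is called a *spectral point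 of positive* (resp. *negative*) *type* of $AG$ if there is a sequence $(x_n)$ in $\operatorname{dom}(AG)$ with $\|x_n\|=1$ for all $n$ and $(AG-\lambda)x_n\to0$, and if every such sequence satisfies $\liminf_{n\to\infty}[x_n,x_n]>0$ (resp. $\limsup_{n\to\infty}[x_n,x_n]<0$). With these notions (for every such $\lambda_0$): (b) If $\lambda\in\sigma(AG)\cap(\mathbb R\setminus\{0\})$ and $p(\lambda)>0$ for some definitizing polynomial $p$ for $(A,G)$, then $\lambda$ is a spectral point of positive type of $AG$. (c) If $\lambda\in\sigma(AG)\cap(\mathbb R\setminus\{0\})$ and $p(\lambda)<0$ for some definitizing polynomial $p$ for $(A,G)$, then $\lambda$ is a spectral point of negative type of $AG$. -/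

import Mathlib

open Filter Topology
open scoped ComplexOrder

namespace OpPair

variable {H : Type*} [NormedAddCommGroup H] [InnerProductSpace ℂ H]

/-! ### Products, powers and polynomials of unbounded operators -/

/-- The product `S T` of two (unbounded) operators, with its natural domain
`{x ∈ dom T | T x ∈ dom S}`. -/
def mul (S T : H →ₗ.[ℂ] H) : H →ₗ.[ℂ] H where
  domain :=
    { carrier := {x | ∃ h : x ∈ T.domain, T ⟨x, h⟩ ∈ S.domain}
      add_mem' := by
        rintro x y ⟨hx, hx'⟩ ⟨hy, hy'⟩
        refine ⟨T.domain.add_mem hx hy, ?_⟩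
        have h : T ⟨x + y, T.domain.add_mem hx hy⟩ = T ⟨x, hx⟩ + T ⟨y, hy⟩ :=
          T.map_add ⟨x, hx⟩ ⟨y, hy⟩
        rw [h]
        exact S.domain.add_mem hx' hy'
      zero_mem' := by
        refine ⟨T.domain.zero_mem, ?_⟩
        have h : T ⟨0, T.domain.zero_mem⟩ = 0 := T.map_zero
        rw [h]
        exact S.domain.zero_mem
      smul_mem' := by
        rintro c x ⟨hx, hx'⟩
        refine ⟨T.domain.smul_mem c hx, ?_⟩
        have h : T ⟨c • x, T.domain.smul_mem c hx⟩ = c • T ⟨x, hx⟩ :=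
          T.map_smul c ⟨x, hx⟩
        rw [h]
        exact S.domain.smul_mem c hx' }
  toFun :=
    { toFun := fun x => S ⟨T ⟨(x : H), x.2.1⟩, x.2.2⟩
      map_add' := by
        rintro ⟨x, hx, hx'⟩ ⟨y, hy, hy'⟩
        have h : T ⟨x + y, T.domain.add_mem hx hy⟩ = T ⟨x, hx⟩ + T ⟨y, hy⟩ :=
          T.map_add ⟨x, hx⟩ ⟨y, hy⟩
        rw [← S.map_add]
        congr 1
        exact Subtype.ext h
      map_smul' := by
        rintro c ⟨x, hx, hx'⟩
        have h : T ⟨c • x, T.domain.smul_mem c hx⟩ = c • T ⟨x, hx⟩ :=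
          T.map_smul c ⟨x, hx⟩
        rw [RingHom.id_apply, ← S.map_smul]
        congr 1
        exact Subtype.ext h }

theorem mem_mul_domain {S T : H →ₗ.[ℂ] H} {x : H} :
    x ∈ (mul S T).domain ↔ ∃ h : x ∈ T.domain, T ⟨x, h⟩ ∈ S.domain := Iff.rfl

theorem mul_apply {S T : H →ₗ.[ℂ] H} (x : (mul S T).domain) :
    mul S T x = S ⟨T ⟨(x : H), x.2.1⟩, x.2.2⟩ := rfl

/-- The powers `T ^ n` of an operator: `T ^ 0` is the identity on the whole space and
`T ^ (n + 1) = T T ^ n`. -/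
def pow (T : H →ₗ.[ℂ] H) : ℕ → (H →ₗ.[ℂ] H)
  | 0 => (LinearMap.id : H →ₗ[ℂ] H).toPMap ⊤
  | n + 1 => mul T (pow T n)

theorem pow_domain_anti (T : H →ₗ.[ℂ] H) {m n : ℕ} (h : m ≤ n) :
    (pow T n).domain ≤ (pow T m).domain := by
  induction n, h using Nat.le_induction with
  | base => exact le_rfl
  | succ n _ ih => exact fun x hx => ih hx.1

theorem pow_one_domain (T : H →ₗ.[ℂ] H) : (pow T 1).domain = T.domain := by
  ext x
  exact ⟨fun hx => hx.2, fun hx => ⟨Submodule.mem_top, hx⟩⟩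

/-- `p(T) = ∑ k ≤ d, aₖ T ^ k` for a real polynomial `p = ∑ k ≤ d, aₖ X ^ k` of degree `d`, with
domain `dom T ^ d`. -/
noncomputable def polyOp (p : Polynomial ℝ) (T : H →ₗ.[ℂ] H) : H →ₗ.[ℂ] H where
  domain := (pow T p.natDegree).domain
  toFun := ∑ k : Fin (p.natDegree + 1), ((p.coeff k : ℝ) : ℂ) •
    ((pow T k).toFun ∘ₗ Submodule.inclusion (pow_domain_anti T (Nat.le_of_lt_succ k.2)))

theorem polyOp_apply (p : Polynomial ℝ) (T : H →ₗ.[ℂ] H) (x : (polyOp p T).domain) :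
    polyOp p T x = ∑ k : Fin (p.natDegree + 1), ((p.coeff k : ℝ) : ℂ) •
      pow T k ⟨(x : H), pow_domain_anti T (Nat.le_of_lt_succ k.2) x.2⟩ :=
  LinearMap.sum_apply Finset.univ (fun k : Fin (p.natDegree + 1) => ((p.coeff k : ℝ) : ℂ) •
    ((pow T k).toFun ∘ₗ Submodule.inclusion
      (pow_domain_anti T (Nat.le_of_lt_succ k.2)))) x

/-! ### Resolvent set, spectrum, poles of the resolvent -/

/-- `R` is a bounded, everywhere defined, two-sided inverse of `T - μ : dom T → H`. -/
def IsResolventAt (T : H →ₗ.[ℂ] H) (μ : ℂ) (R : H →L[ℂ] H) : Prop :=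
  (∀ x : T.domain, R (T x - μ • (x : H)) = x) ∧
    ∀ y : H, ∃ x : T.domain, (x : H) = R y ∧ T x - μ • (x : H) = y

/-- The resolvent set: all `μ` such that `T - μ` is a bijection of `dom T` onto `H` with bounded
inverse. -/
def resolventSet (T : H →ₗ.[ℂ] H) : Set ℂ := {μ | ∃ R : H →L[ℂ] H, IsResolventAt T μ R}

/-- The spectrum of an operator. -/
def spectrum (T : H →ₗ.[ℂ] H) : Set ℂ := (resolventSet T)ᶜ

open Classical in
/-- The resolvent `μ ↦ (T - μ)⁻¹`, with the value `0` outside the resolvent set. -/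
noncomputable def resolvent (T : H →ₗ.[ℂ] H) (μ : ℂ) : H →L[ℂ] H :=
  if h : ∃ R : H →L[ℂ] H, IsResolventAt T μ R then h.choose else 0

theorem resolvent_spec {T : H →ₗ.[ℂ] H} {μ : ℂ} (h : μ ∈ resolventSet T) :
    IsResolventAt T μ (resolvent T μ) := by
  have h' : ∃ R : H →L[ℂ] H, IsResolventAt T μ R := h
  rw [resolvent, dif_pos h']
  exact h'.choose_spec

/-- `z` is a pole of the resolvent of `T`: the resolvent is defined in a punctured neighbourhood
of `z`, where it has a Laurent expansion (in operator norm) with finitely many, but at least one,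
terms of negative order. -/
def IsPoleOfResolvent (T : H →ₗ.[ℂ] H) (z : ℂ) : Prop :=
  (∀ᶠ μ in 𝓝[≠] z, μ ∈ resolventSet T) ∧
    MeromorphicAt (resolvent T) z ∧ meromorphicOrderAt (resolvent T) z < 0

/-! ### Spectral points of positive and negative type -/

/-- `x` is a sequence of unit vectors of `dom T` with `(T - z) xₙ → 0`. -/
def IsApproxEigenseq (T : H →ₗ.[ℂ] H) (z : ℂ) (x : ℕ → T.domain) : Prop :=
  (∀ n, ‖(x n : H)‖ = 1) ∧ Tendsto (fun n => T (x n) - z • (x n : H)) atTop (𝓝 0)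

/-- The approximate point spectrum. -/
def approxPointSpectrum (T : H →ₗ.[ℂ] H) : Set ℂ :=
  {z | ∃ x : ℕ → T.domain, IsApproxEigenseq T z x}

/-- `[x, y] = (G₀ x, y)`, linear in `x` and conjugate linear in `y` (Mathlib's inner product is
conjugate linear in its first argument). -/
noncomputable def bracket (G₀ : H →L[ℂ] H) (x y : H) : ℂ := inner ℂ y (G₀ x)

/-- A closed, densely defined operator `T` with `[T x, y] = [x, T y]` on `dom T`. -/
def IsBracketSymmetric (G₀ : H →L[ℂ] H) (T : H →ₗ.[ℂ] H) : Prop :=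
  T.IsClosed ∧ Dense (T.domain : Set H) ∧
    ∀ x y : T.domain, bracket G₀ (T x) y = bracket G₀ x (T y)

/-- The spectral points of positive type of `T` with respect to `[·,·] = (G₀ ·, ·)`. The numbers
`[xₙ, xₙ]` are real, as `G₀` is selfadjoint, and bounded by `‖G₀‖`. -/
def posType (G₀ : H →L[ℂ] H) (T : H →ₗ.[ℂ] H) : Set ℂ :=
  {z | z ∈ approxPointSpectrum T ∧ ∀ x : ℕ → T.domain, IsApproxEigenseq T z x →
    0 < liminf (fun n => (bracket G₀ (x n) (x n)).re) atTop}

/-- The spectral points of negative type of `T` with respect to `[·,·] = (G₀ ·, ·)`. -/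
def negType (G₀ : H →L[ℂ] H) (T : H →ₗ.[ℂ] H) : Set ℂ :=
  {z | z ∈ approxPointSpectrum T ∧ ∀ x : ℕ → T.domain, IsApproxEigenseq T z x →
    limsup (fun n => (bracket G₀ (x n) (x n)).re) atTop < 0}

/-! ### Pairs of selfadjoint operators -/

/-- `G₀` is the bounded, everywhere defined, selfadjoint operator
`G (AG - z)⁻¹ (AG - z̄)⁻¹`, where both `z` and `z̄` belong to the resolvent set of `AG`. -/
def IsGramOperator [CompleteSpace H] (A G : H →ₗ.[ℂ] H) (z : ℂ) (G₀ : H →L[ℂ] H) : Prop :=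
  z ∈ resolventSet (mul A G) ∧ star z ∈ resolventSet (mul A G) ∧ IsSelfAdjoint G₀ ∧
    ∀ x : H, ∃ u : G.domain,
      (u : H) = resolvent (mul A G) z (resolvent (mul A G) (star z) x) ∧ G u = G₀ x

/-- `dom (AG)ⁿ ⊆ dom G` for `n ≥ 1`. -/
theorem pow_mul_domain_le (A G : H →ₗ.[ℂ] H) {n : ℕ} (hn : 1 ≤ n) :
    (pow (mul A G) n).domain ≤ G.domain := by
  intro x hx
  have h := pow_domain_anti (mul A G) hn hx
  rw [pow_one_domain] at h
  exact h.1

/-- The real polynomial `p ≠ 0` is definitizing for `(A, G)`: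
`(p(AG) x, G x) ≥ 0` for all `x ∈ dom (AG) ^ max {1, deg p}`. -/
def IsDefinitizing (A G : H →ₗ.[ℂ] H) (p : Polynomial ℝ) : Prop :=
  p ≠ 0 ∧ ∀ x : (pow (mul A G) (max 1 p.natDegree)).domain,
    0 ≤ inner ℂ (G ⟨(x : H), pow_mul_domain_le A G (le_max_left _ _) x.2⟩)
      (polyOp p (mul A G) ⟨(x : H), pow_domain_anti (mul A G) (le_max_right _ _) x.2⟩)

/-- A pair `(A, G)` of selfadjoint operators is definitizable if `AG` and `GA` have non-empty
resolvent sets and there is a definitizing polynomial. -/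
def IsDefinitizable [CompleteSpace H] (A G : H →ₗ.[ℂ] H) : Prop :=
  IsSelfAdjoint A ∧ IsSelfAdjoint G ∧
    (resolventSet (mul A G)).Nonempty ∧ (resolventSet (mul G A)).Nonempty ∧
    ∃ p : Polynomial ℝ, IsDefinitizing A G p

end OpPair

/-!
The argument works with one resolvent `S = (T - l̄)⁻¹` of `T = AG`, at a point `l ≠ 0`, and with
bounded operators built from it.

*The products.* For `l ≠ 0` the formula `(GA - l)⁻¹ = l⁻¹ (G (AG - l)⁻¹ A - 1)` shows that `AG` and
`GA` have the same resolvent set off `0` (`mem_resolventSet_mul_swap`). From a common point of the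
two resolvent sets one obtains that `AG` is densely defined and that `((AG - l)⁻¹)* = (GA - l̄)⁻¹`
(`dense_domain_mul`, `IsResolventAt.adjoint_mul`); in particular the resolvent set of `AG` is
symmetric off `0`. Consequently a point `z ≠ 0` at which `AG - z` is bounded below and such that
`z̄` is not an eigenvalue lies in the resolvent set (`mem_resolventSet_of_bounded_below`). No
connectedness argument is needed.

*The estimate.* Let `p` be definitizing of degree `d`, and `y = S ^ (d + 1) x`. The form
`(p(T) y, G y)` is positive semi-definite and bounded in `x`, so by the Cauchy-Schwarz inequality
its square root dominates a smoothed norm of `p(T) y`. Up to an error of the size of the defect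
`S (T - μ) x`, the vector `p(T) y` is `p(μ) y`, the vector `T y` is `μ y`, and `x` is a multiple of
`S ^ n x` for any `n`. This gives, locally uniformly in `μ`,
`‖μ p(μ)‖² ‖x‖² ≤ c Re (p(μ) (y, G y)) + c' ‖S (T - μ) x‖ ‖x‖`
(`ResolventData.exists_norm_sq_le`).

*Non-real points.* Since `(y, G y)` and `(T y, G y)` are real, `|Im μ| |(y, G y)|` is bounded by the
defect, and hence `‖(T - μ)⁻¹‖ ≤ C / (|Im μ| |μ p(μ)|²)`. So non-real points that are not zeros of
`p` belong to the resolvent set, and at a zero the function `p² (T - ·)⁻¹` stays bounded, which by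
the removable singularity theorem makes the zero at worst a pole.

*Real points.* A real point `t ≠ 0` of the spectrum is an approximate eigenvalue. Along an
approximate eigensequence `(x_n)` the defects tend to `0`, and `(y, G y)` is asymptotically a positive
multiple of `[x_n, x_n] = (S x_n, G S x_n)`; the estimate bounds `p(t) [x_n, x_n]` away from `0` from
below.
-/

namespace OpPair

/-! ### Graphs, resolvents and the closed graph theorem -/

section Resolvent

variable {H : Type*} [NormedAddCommGroup H] [InnerProductSpace ℂ H]

theorem mem_graph_mul {S T : H →ₗ.[ℂ] H} {x z : H} :
    (x, z) ∈ (mul S T).graph ↔ ∃ y, (x, y) ∈ T.graph ∧ (y, z) ∈ S.graph := by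
  simp only [LinearPMap.mem_graph_iff]
  constructor
  · rintro ⟨⟨u, hu, hu'⟩, rfl, rfl⟩
    exact ⟨T ⟨u, hu⟩, ⟨⟨u, hu⟩, rfl, rfl⟩, ⟨_, hu'⟩, rfl, rfl⟩
  · rintro ⟨y, ⟨u, rfl, rfl⟩, v, hv, rfl⟩
    have hmem : T ⟨(u : H), u.2⟩ ∈ S.domain := by
      rw [← hv]
      exact v.2
    refine ⟨⟨u, u.2, hmem⟩, rfl, ?_⟩
    rw [mul_apply]
    congr 1
    exact Subtype.ext hv.symm

/-- A bounded operator `R` is the resolvent of `T` at `μ` exactly when it describes the graph of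
`T` through `z = T x ↔ R (z - μ x) = x`. -/
theorem isResolventAt_iff {T : H →ₗ.[ℂ] H} {μ : ℂ} {R : H →L[ℂ] H} :
    IsResolventAt T μ R ↔ ∀ x z, (x, z) ∈ T.graph ↔ R (z - μ • x) = x := by
  constructor
  · rintro ⟨h1, h2⟩ x z
    constructor
    · intro h
      obtain ⟨u, rfl, rfl⟩ := (LinearPMap.mem_graph_iff T).1 h
      exact h1 u
    · intro h
      obtain ⟨u, hu, hu'⟩ := h2 (z - μ • x)
      refine (LinearPMap.mem_graph_iff T).2 ⟨u, hu.trans h, ?_⟩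
      rwa [hu, h, sub_left_inj] at hu'
  · intro h
    refine ⟨fun x => (h _ _).1 (T.mem_graph x), fun y => ?_⟩
    have : (R y, y + μ • R y) ∈ T.graph := (h _ _).2 (by simp)
    obtain ⟨u, hu, hu'⟩ := (LinearPMap.mem_graph_iff T).1 this
    exact ⟨u, hu, by simp only [hu', hu, add_sub_cancel_right]⟩

theorem IsResolventAt.mem_graph {T : H →ₗ.[ℂ] H} {μ : ℂ} {R : H →L[ℂ] H}
    (h : IsResolventAt T μ R) (y : H) : (R y, y + μ • R y) ∈ T.graph :=
  (isResolventAt_iff.1 h _ _).2 (by simp)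

theorem IsResolventAt.apply_eq {T : H →ₗ.[ℂ] H} {μ : ℂ} {R : H →L[ℂ] H}
    (h : IsResolventAt T μ R) {x z : H} (hx : (x, z) ∈ T.graph) : R (z - μ • x) = x :=
  (isResolventAt_iff.1 h _ _).1 hx

theorem IsResolventAt.unique {T : H →ₗ.[ℂ] H} {μ : ℂ} {R R' : H →L[ℂ] H}
    (h : IsResolventAt T μ R) (h' : IsResolventAt T μ R') : R = R' := by
  ext y
  simpa using (h'.apply_eq (h.mem_graph y)).symm

theorem IsResolventAt.resolvent_eq {T : H →ₗ.[ℂ] H} {μ : ℂ} {R : H →L[ℂ] H}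
    (h : IsResolventAt T μ R) : resolvent T μ = R :=
  (resolvent_spec (T := T) ⟨R, h⟩).unique h

theorem IsResolventAt.isClosed {T : H →ₗ.[ℂ] H} {μ : ℂ} {R : H →L[ℂ] H}
    (h : IsResolventAt T μ R) : T.IsClosed := by
  have : (T.graph : Set (H × H)) = {q | R (q.2 - μ • q.1) = q.1} := by
    ext ⟨x, z⟩
    exact isResolventAt_iff.1 h x z
  rw [LinearPMap.IsClosed, this]
  exact isClosed_eq (by fun_prop) (by fun_prop)

theorem isClosed_of_resolventSet_nonempty {T : H →ₗ.[ℂ] H} (h : (resolventSet T).Nonempty) :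
    T.IsClosed := by
  obtain ⟨μ, R, hR⟩ := h
  exact hR.isClosed

/-- The resolvent identity in factored form. -/
theorem IsResolventAt.comp_one_add {T : H →ₗ.[ℂ] H} {μ ν : ℂ} {R S : H →L[ℂ] H}
    (hR : IsResolventAt T μ R) (hS : IsResolventAt T ν S) :
    R = S * (1 + (μ - ν) • R) := by
  ext y
  refine (hS.apply_eq (hR.mem_graph y)).symm.trans (congrArg S ?_)
  simp [sub_smul, add_sub_assoc]

theorem IsResolventAt.commute {T : H →ₗ.[ℂ] H} {μ ν : ℂ} {R S : H →L[ℂ] H}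
    (hR : IsResolventAt T μ R) (hS : IsResolventAt T ν S) : Commute R S := by
  have h1 := hR.comp_one_add hS
  have h2 := hS.comp_one_add hR
  rw [mul_add, mul_one, mul_smul_comm] at h1 h2
  have h3 : (μ - ν) • (R * S - S * R) = 0 := by
    have h4 : (μ - ν) • (S * R) = R - S := (sub_eq_of_eq_add' h1).symm
    have h5 : (ν - μ) • (R * S) = S - R := (sub_eq_of_eq_add' h2).symm
    rw [smul_sub, h4, ← neg_sub ν, neg_smul, h5]
    abel
  rcases smul_eq_zero.1 h3 with h4 | h4
  · rw [h4, zero_smul, add_zero] at h1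
    rw [h1]
  · exact sub_eq_zero.1 h4

theorem eventually_mul_norm_lt_one {μ : ℂ} (R : H →L[ℂ] H) :
    ∀ᶠ ν in 𝓝 μ, ‖ν - μ‖ * ‖R‖ < 1 := by
  have : Tendsto (fun ν => ‖ν - μ‖ * ‖R‖) (𝓝 μ) (𝓝 (‖μ - μ‖ * ‖R‖)) :=
    Continuous.tendsto (by fun_prop) μ
  exact this.eventually_lt_const (by simp)

variable [CompleteSpace H]

/-- Closed graph theorem: for a closed operator `T`, if `T - μ` is a bijection of `dom T` onto the
whole space, then `μ` is in the resolvent set. -/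
theorem mem_resolventSet_of_bijective {T : H →ₗ.[ℂ] H} (hT : T.IsClosed) {μ : ℂ}
    (hinj : ∀ x, (x, μ • x) ∈ T.graph → x = 0)
    (hsurj : ∀ y, ∃ x, (x, y + μ • x) ∈ T.graph) : μ ∈ resolventSet T := by
  choose r hr using hsurj
  have huniq : ∀ x x' y, (x, y + μ • x) ∈ T.graph → (x', y + μ • x') ∈ T.graph → x = x' := by
    intro x x' y h h'
    refine sub_eq_zero.1 (hinj _ ?_)
    have := T.graph.sub_mem h h'
    rwa [Prod.mk_sub_mk, add_sub_add_left_eq_sub, ← smul_sub] at this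
  let L : H →ₗ[ℂ] H :=
    { toFun := r
      map_add' := fun y y' => by
        refine huniq _ _ _ (hr _) ?_
        have := T.graph.add_mem (hr y) (hr y')
        rwa [Prod.mk_add_mk, add_add_add_comm, ← smul_add] at this
      map_smul' := fun c y => by
        refine huniq _ _ _ (hr _) ?_
        have := T.graph.smul_mem c (hr y)
        rwa [Prod.smul_mk, smul_add, smul_comm c μ] at this }
  have hgraph : (L.graph : Set (H × H)) =
      (fun q : H × H => (q.2, q.1 + μ • q.2)) ⁻¹' (T.graph : Set (H × H)) := by
    ext ⟨y, x⟩
    simp only [SetLike.mem_coe, LinearMap.mem_graph_iff, Set.mem_preimage]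
    exact ⟨fun h => h ▸ hr y, fun h => huniq _ _ _ h (hr y)⟩
  have hcont : Continuous L := L.continuous_of_isClosed_graph (by
    rw [hgraph]
    exact IsClosed.preimage (by fun_prop) hT)
  refine ⟨⟨L, hcont⟩, isResolventAt_iff.2 fun x z => ⟨fun h => ?_, fun h => ?_⟩⟩
  · exact huniq _ _ (z - μ • x) (hr _) (by simpa using h)
  · have := hr (z - μ • x)
    change r (z - μ • x) = x at h
    simpa [h] using this

/-- If a bounded operator `R` maps into `dom A` and `A` is closed, then `A R` is bounded. -/
theorem exists_clm_comp {A : H →ₗ.[ℂ] H} (hA : A.IsClosed) (R : H →L[ℂ] H)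
    (hR : ∀ y, R y ∈ A.domain) : ∃ B : H →L[ℂ] H, ∀ y, (R y, B y) ∈ A.graph := by
  let L : H →ₗ[ℂ] H := A.toFun ∘ₗ (R : H →ₗ[ℂ] H).codRestrict A.domain hR
  have hL : ∀ y, (R y, L y) ∈ A.graph := fun y => A.mem_graph ⟨R y, hR y⟩
  have hgraph : (L.graph : Set (H × H)) =
      (fun q : H × H => (R q.1, q.2)) ⁻¹' (A.graph : Set (H × H)) := by
    ext ⟨y, x⟩
    simp only [SetLike.mem_coe, LinearMap.mem_graph_iff, Set.mem_preimage]
    exact ⟨fun h => h ▸ hL y, fun h => A.mem_graph_snd_inj h (hL y) rfl⟩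
  have hcont : Continuous L := L.continuous_of_isClosed_graph (by
    rw [hgraph]
    exact IsClosed.preimage (by fun_prop) hA)
  exact ⟨⟨L, hcont⟩, hL⟩

/-- Neumann series: the resolvent at `ν` near `μ`. -/
theorem IsResolventAt.neumann {T : H →ₗ.[ℂ] H} {μ ν : ℂ} {R : H →L[ℂ] H}
    (h : IsResolventAt T μ R) (hν : ‖ν - μ‖ * ‖R‖ < 1) :
    IsResolventAt T ν (R * Ring.inverse (1 - (ν - μ) • R)) := by
  have hu : IsUnit (1 - (ν - μ) • R) :=
    isUnit_one_sub_of_norm_lt_one (by rwa [norm_smul])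
  obtain ⟨U, hU⟩ := hu
  have hcomm : Commute R (U : H →L[ℂ] H) := by
    rw [hU]
    exact (Commute.one_right R).sub_right ((Commute.refl R).smul_right _)
  rw [← hU, Ring.inverse_unit]
  have key : ∀ x z : H, R (z - ν • x) - (U : H →L[ℂ] H) x = R (z - μ • x) - x := by
    intro x z
    rw [hU]
    simp only [map_sub, map_smul, sub_apply, one_apply_eq_self,
      smul_apply, sub_smul]
    abel
  refine isResolventAt_iff.2 fun x z => ?_
  rw [isResolventAt_iff.1 h, ← sub_eq_zero, ← key, sub_eq_zero, (hcomm.units_inv_right).eq]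
  rw [mul_apply_eq_comp]
  constructor
  · intro h
    rw [h, ← mul_apply_eq_comp, Units.inv_mul, one_apply_eq_self]
  · intro h
    conv_rhs => rw [← h]
    rw [← mul_apply_eq_comp, Units.mul_inv, one_apply_eq_self]

theorem isOpen_resolventSet (T : H →ₗ.[ℂ] H) : IsOpen (resolventSet T) := by
  refine isOpen_iff_mem_nhds.2 fun μ ⟨R, hR⟩ => ?_
  filter_upwards [eventually_mul_norm_lt_one R] with ν hν
  exact ⟨_, hR.neumann hν⟩

theorem exists_ne_zero_mem_resolventSet {T : H →ₗ.[ℂ] H} (h : (resolventSet T).Nonempty) :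
    ∃ l ∈ resolventSet T, l ≠ 0 := by
  obtain ⟨l, h1, h2⟩ := (dense_compl_singleton (0 : ℂ)).inter_open_nonempty _
    (isOpen_resolventSet T) h
  exact ⟨l, h1, h2⟩

theorem differentiableAt_resolvent {T : H →ₗ.[ℂ] H} {μ : ℂ} (hμ : μ ∈ resolventSet T) :
    DifferentiableAt ℂ (resolvent T) μ := by
  obtain ⟨R, hR⟩ := hμ
  have hev : resolvent T =ᶠ[𝓝 μ] fun ν => R * Ring.inverse (1 - (ν - μ) • R) := by
    filter_upwards [eventually_mul_norm_lt_one R] with ν hν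
    exact (hR.neumann hν).resolvent_eq
  refine DifferentiableAt.congr_of_eventuallyEq ?_ hev
  have h1 : DifferentiableAt ℂ (Ring.inverse : (H →L[ℂ] H) → (H →L[ℂ] H)) (1 - (μ - μ) • R) := by
    simpa using differentiableAt_inverse (𝕜 := ℂ) (1 : (H →L[ℂ] H)ˣ).isUnit
  have h2 : DifferentiableAt ℂ (fun ν : ℂ => 1 - (ν - μ) • R) μ := by fun_prop
  exact (h1.comp μ h2).const_mul R

/-- At a point of the spectrum to which the resolvent set accumulates, the resolvent cannot
stay bounded. -/
theorem mem_resolventSet_of_bounded {T : H →ₗ.[ℂ] H} {z : ℂ} {M : ℝ}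
    (h : ∀ᶠ μ in 𝓝[≠] z, μ ∈ resolventSet T ∧ ‖resolvent T μ‖ ≤ M) : z ∈ resolventSet T := by
  have h2 : ∀ᶠ μ in 𝓝[≠] z, ‖z - μ‖ * M < 1 := by
    have : Tendsto (fun μ => ‖z - μ‖ * M) (𝓝 z) (𝓝 (‖z - z‖ * M)) :=
      Continuous.tendsto (by fun_prop) z
    exact (this.eventually_lt_const (by simp)).filter_mono nhdsWithin_le_nhds
  obtain ⟨μ, ⟨h3, h4⟩, h5⟩ := (h.and h2).exists
  exact ⟨_, (resolvent_spec h3).neumann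
    ((mul_le_mul_of_nonneg_left h4 (norm_nonneg _)).trans_lt h5)⟩

end Resolvent

/-! ### Resolvents and adjoints of the products `AG` and `GA` -/

section Products

variable {H : Type*} [NormedAddCommGroup H] [InnerProductSpace ℂ H]

/-- Points `l ≠ 0` of the resolvent set of `AG` belong to that of `GA`, provided the latter is
non-empty: `x = l⁻¹ (G (AG - l)⁻¹ A y - y)` solves `(GA - l) x = y` for `y ∈ dom A`, and a general
right-hand side is moved into `dom A` by a resolvent of `GA` at some other point. -/
theorem mem_resolventSet_mul_swap [CompleteSpace H] {A G : H →ₗ.[ℂ] H} {l : ℂ}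
    (hne : (resolventSet (mul G A)).Nonempty) (hl : l ≠ 0)
    (h : l ∈ resolventSet (mul A G)) : l ∈ resolventSet (mul G A) := by
  obtain ⟨R, hR⟩ := h
  refine mem_resolventSet_of_bijective (isClosed_of_resolventSet_nonempty hne) ?_ ?_
  · intro x hx
    obtain ⟨y, hxy, hyx⟩ := mem_graph_mul.1 hx
    have hy : (y, l • y) ∈ (mul A G).graph :=
      mem_graph_mul.2 ⟨l • x, hyx, by simpa using A.graph.smul_mem l hxy⟩
    have hy0 : y = 0 := by simpa using (hR.apply_eq hy).symm
    rw [hy0] at hyx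
    exact (smul_eq_zero.1 (G.graph_fst_eq_zero_snd hyx rfl)).resolve_left hl
  · intro y
    obtain ⟨m, Q, hQ⟩ := hne
    obtain ⟨w, hvw, hw⟩ := mem_graph_mul.1 (hQ.mem_graph y)
    obtain ⟨g, hug, hg⟩ := mem_graph_mul.1 (hR.mem_graph ((l - m) • w))
    set v := Q y
    set u := R ((l - m) • w)
    have h1 : (l⁻¹ • (g - (l - m) • v), u) ∈ A.graph := by
      have := A.graph.smul_mem l⁻¹ (A.graph.sub_mem hg (A.graph.smul_mem (l - m) hvw))
      simpa [smul_smul, hl] using this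
    refine ⟨l⁻¹ • (g - (l - m) • v) + v, mem_graph_mul.2 ⟨u + w, ?_, ?_⟩⟩
    · exact A.graph.add_mem h1 hvw
    · have hsum : (u + w, g + (y + m • v)) ∈ G.graph := G.graph.add_mem hug hw
      have : y + l • (l⁻¹ • (g - (l - m) • v) + v) = g + (y + m • v) := by
        rw [smul_add, smul_inv_smul₀ hl]
        module
      rwa [this]

/-- The resolvents of `AG` and `GA` at a common point are intertwined by `G`:
`(GA - l)⁻¹ G ⊆ G (AG - l)⁻¹`. -/
theorem IsResolventAt.intertwine {A G : H →ₗ.[ℂ] H} {l : ℂ} {R R' : H →L[ℂ] H}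
    (hR : IsResolventAt (mul A G) l R) (hR' : IsResolventAt (mul G A) l R') {x x' : H}
    (hx : (x, x') ∈ G.graph) : (R x, R' x') ∈ G.graph := by
  obtain ⟨g, h1, h2⟩ := mem_graph_mul.1 (hR.mem_graph x)
  have h3 : (g, x' + l • g) ∈ (mul G A).graph :=
    mem_graph_mul.2 ⟨_, h2, by simpa using G.graph.add_mem hx (G.graph.smul_mem l h1)⟩
  have := hR'.apply_eq h3
  rw [add_sub_cancel_right] at this
  rwa [this]

/-- If `G` is closed, then `G (AG - l)⁻¹` is bounded. -/
theorem IsResolventAt.exists_comp [CompleteSpace H] {A G : H →ₗ.[ℂ] H} (hG : G.IsClosed) {l : ℂ}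
    {R : H →L[ℂ] H} (hR : IsResolventAt (mul A G) l R) :
    ∃ C : H →L[ℂ] H, ∀ y, (R y, C y) ∈ G.graph ∧ (C y, y + l • R y) ∈ A.graph := by
  obtain ⟨C, hC⟩ := exists_clm_comp hG R fun y => by
    obtain ⟨g, h1, -⟩ := mem_graph_mul.1 (hR.mem_graph y)
    exact G.mem_domain_of_mem_graph h1
  refine ⟨C, fun y => ⟨hC y, ?_⟩⟩
  obtain ⟨g, h1, h2⟩ := mem_graph_mul.1 (hR.mem_graph y)
  rwa [G.mem_graph_snd_inj (hC y) h1 rfl]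

theorem inner_eq_of_isSelfAdjoint [CompleteSpace H] {A : H →ₗ.[ℂ] H} (hA : IsSelfAdjoint A)
    {x x' y y' : H} (hx : (x, x') ∈ A.graph) (hy : (y, y') ∈ A.graph) :
    inner ℂ x' y = inner ℂ x y' := by
  have h := LinearPMap.adjoint_isFormalAdjoint hA.dense_domain
  rw [LinearPMap.isSelfAdjoint_def.1 hA] at h
  obtain ⟨u, rfl, rfl⟩ := (LinearPMap.mem_graph_iff A).1 hx
  obtain ⟨v, rfl, rfl⟩ := (LinearPMap.mem_graph_iff A).1 hy
  exact h u v

theorem mem_graph_of_isSelfAdjoint [CompleteSpace H] {A : H →ₗ.[ℂ] H} (hA : IsSelfAdjoint A)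
    {y w : H} (h : ∀ x x', (x, x') ∈ A.graph → inner ℂ x' y = inner ℂ x w) :
    (y, w) ∈ A.graph := by
  have h' : ∀ x : A.domain, inner ℂ w (x : H) = inner ℂ y (A x) := fun x => by
    rw [← inner_conj_symm, ← h _ _ (A.mem_graph x), inner_conj_symm]
  have hy := A.mem_adjoint_domain_of_exists y ⟨w, h'⟩
  have hy' := LinearPMap.adjoint_apply_eq hA.dense_domain ⟨y, hy⟩ h'
  rw [← LinearPMap.isSelfAdjoint_def.1 hA, LinearPMap.mem_graph_iff]
  exact ⟨⟨y, hy⟩, rfl, hy'⟩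

variable [CompleteSpace H] {A G : H →ₗ.[ℂ] H}

/-- For `x ∈ dom G` one has `x = A (GA - l)⁻¹ G x - l (AG - l)⁻¹ x`; the second summand lies in
`dom AG`, and the first one is a limit of elements of `dom AG` because the bounded operator
`A (GA - l)⁻¹` maps the dense subspace `dom A` into `dom AG`. -/
theorem dense_domain_mul (hA : IsSelfAdjoint A) (hG : IsSelfAdjoint G) {l : ℂ}
    (h : l ∈ resolventSet (mul A G)) (h' : l ∈ resolventSet (mul G A)) :
    Dense ((mul A G).domain : Set H) := by
  obtain ⟨R, hR⟩ := h
  obtain ⟨R', hR'⟩ := h'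
  obtain ⟨B, hB⟩ := hR'.exists_comp hA.isClosed
  have hsub : ∀ g ∈ (A.domain : Set H), B g ∈ ((mul A G).domain : Set H) := by
    intro g hg
    have h1 : (g, A ⟨g, hg⟩) ∈ A.graph := A.mem_graph ⟨g, hg⟩
    exact (mul A G).mem_domain_of_mem_graph (mem_graph_mul.2 ⟨_, (hB g).2,
      A.graph.add_mem h1 (A.graph.smul_mem l (hB g).1)⟩)
  have hG' : G.domain ≤ (mul A G).domain.topologicalClosure := by
    intro x hx
    have hx' : (x, G ⟨x, hx⟩) ∈ G.graph := G.mem_graph ⟨x, hx⟩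
    set x' := G ⟨x, hx⟩
    obtain ⟨g, h1, h2⟩ := mem_graph_mul.1 (hR.mem_graph x)
    have h3 : B x' = x + l • R x := by
      rw [G.mem_graph_snd_inj h1 (hR.intertwine hR' hx') rfl] at h2
      exact A.mem_graph_snd_inj (hB x').1 h2 rfl
    have h4 : B x' ∈ (mul A G).domain.topologicalClosure :=
      map_mem_closure B.continuous (hA.dense_domain x') hsub
    have h5 : R x ∈ (mul A G).domain.topologicalClosure :=
      Submodule.le_topologicalClosure _ ((mul A G).mem_domain_of_mem_graph (hR.mem_graph x))
    have h6 := Submodule.sub_mem _ h4 (Submodule.smul_mem _ l h5)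
    rwa [h3, add_sub_cancel_right] at h6
  have : Dense ((mul A G).domain.topologicalClosure : Set H) := hG.dense_domain.mono hG'
  rwa [Submodule.topologicalClosure_coe, dense_closure] at this

/-- `((AG - l)⁻¹)* = (GA - l̄)⁻¹` at a common point `l` of the two resolvent sets. -/
theorem IsResolventAt.adjoint_mul (hA : IsSelfAdjoint A) (hG : IsSelfAdjoint G) {l : ℂ}
    {R R' : H →L[ℂ] H} (hR : IsResolventAt (mul A G) l R)
    (hR' : IsResolventAt (mul G A) l R') :
    IsResolventAt (mul G A) (star l) (ContinuousLinearMap.adjoint R) := by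
  refine isResolventAt_iff.2 fun x z => ⟨fun h => ?_, fun h => ?_⟩
  · obtain ⟨y, h1, h2⟩ := mem_graph_mul.1 h
    refine ext_inner_right ℂ fun w => ?_
    obtain ⟨g, h3, h4⟩ := mem_graph_mul.1 (hR.mem_graph w)
    rw [ContinuousLinearMap.adjoint_inner_left, inner_sub_left, inner_smul_left,
      inner_eq_of_isSelfAdjoint hG h2 h3, inner_eq_of_isSelfAdjoint hA h1 h4,
      inner_add_right, inner_smul_right]
    simp
  · obtain ⟨B, hB⟩ := hR'.exists_comp hA.isClosed
    set g := z - star l • x with hg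
    have hz : z = g + star l • x := by simp [hg]
    refine mem_graph_mul.2 ⟨ContinuousLinearMap.adjoint B g, ?_, ?_⟩
    · refine mem_graph_of_isSelfAdjoint hA fun k k' hk => ?_
      rw [ContinuousLinearMap.adjoint_inner_right, ← h, ContinuousLinearMap.adjoint_inner_right,
        A.mem_graph_snd_inj (hB k).1 (hR'.intertwine hR hk) rfl]
    · refine mem_graph_of_isSelfAdjoint hG fun k k' hk => ?_
      have h3 : B k' = k + l • R k := by
        obtain ⟨y, h1, h2⟩ := mem_graph_mul.1 (hR.mem_graph k)
        rw [G.mem_graph_snd_inj h1 (hR.intertwine hR' hk) rfl] at h2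
        exact A.mem_graph_snd_inj (hB k').1 h2 rfl
      rw [ContinuousLinearMap.adjoint_inner_right, h3, hz, inner_add_left, inner_add_right,
        inner_smul_left, inner_smul_right, ← h, ContinuousLinearMap.adjoint_inner_right]
      simp

/-- Away from `0`, the resolvent set of `AG` is symmetric with respect to the real axis. -/
theorem star_mem_resolventSet_mul (hA : IsSelfAdjoint A) (hG : IsSelfAdjoint G)
    (hAG : (resolventSet (mul A G)).Nonempty) (hGA : (resolventSet (mul G A)).Nonempty)
    {l : ℂ} (hl : l ≠ 0) (h : l ∈ resolventSet (mul A G)) :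
    star l ∈ resolventSet (mul A G) := by
  obtain ⟨R', hR'⟩ := mem_resolventSet_mul_swap hGA hl h
  obtain ⟨R, hR⟩ := h
  exact mem_resolventSet_mul_swap hAG (star_ne_zero.2 hl) ⟨_, hR.adjoint_mul hA hG hR'⟩

/-- If `z ≠ 0`, `AG - z` is bounded below and `z̄` is not an eigenvalue of `AG`, then `z` belongs to
the resolvent set: `AG - z` has closed range, and a vector orthogonal to this range is an
eigenvector of `(AG)* = GA` for `z̄`, so that `A` maps it to an eigenvector of `AG`. -/
theorem mem_resolventSet_of_bounded_below (hA : IsSelfAdjoint A) (hG : IsSelfAdjoint G)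
    (hAG : (resolventSet (mul A G)).Nonempty) (hGA : (resolventSet (mul G A)).Nonempty)
    {z : ℂ} (hz : z ≠ 0) {c : ℝ}
    (hc : ∀ x x', (x, x') ∈ (mul A G).graph → ‖x‖ ≤ c * ‖x' - z • x‖)
    (hinj : ∀ y, (y, star z • y) ∈ (mul A G).graph → y = 0) :
    z ∈ resolventSet (mul A G) := by
  have hclosed := isClosed_of_resolventSet_nonempty hAG
  refine mem_resolventSet_of_bijective hclosed (fun x hx => ?_) ?_
  · simpa using hc _ _ hx
  obtain ⟨l, hl, hl0⟩ := exists_ne_zero_mem_resolventSet hAG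
  obtain ⟨R', hR'⟩ := mem_resolventSet_mul_swap hGA hl0 hl
  obtain ⟨R, hR⟩ := hl
  have hadj := hR.adjoint_mul hA hG hR'
  -- the range of `AG - z` equals that of the bounded operator `(AG - z)(AG - l)⁻¹`
  let L : H →L[ℂ] H := 1 + (l - z) • R
  have hLapp : ∀ y, L y = y + (l - z) • R y := fun y => rfl
  have hL : ∀ y, (R y, L y + z • R y) ∈ (mul A G).graph := by
    intro y
    have : L y + z • R y = y + l • R y := by
      rw [hLapp]
      module
    rw [this]
    exact hR.mem_graph y
  have hrange : IsClosed (LinearMap.range (L : H →ₗ[ℂ] H) : Set H) := by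
    refine IsSeqClosed.isClosed fun u a hu hua => ?_
    choose y hy using hu
    have hy' : ∀ n, L (y n) = u n := hy
    have hcau : CauchySeq fun n => R (y n) := by
      have hucau := hua.cauchySeq
      rw [Metric.cauchySeq_iff'] at hucau ⊢
      intro ε hε
      obtain ⟨N, hN⟩ := hucau (ε / (|c| + 1)) (by positivity)
      refine ⟨N, fun n hn => ?_⟩
      have h1 := hc _ _ ((mul A G).graph.sub_mem (hL (y n)) (hL (y N)))
      have h2 := hN n hn
      rw [dist_eq_norm] at h2 ⊢
      have h3 : L (y n) + z • R (y n) - (L (y N) + z • R (y N)) - z • (R (y n) - R (y N)) =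
          u n - u N := by
        rw [hy', hy', smul_sub]
        abel
      simp only [h3] at h1
      calc _ ≤ c * ‖u n - u N‖ := h1
        _ ≤ (|c| + 1) * ‖u n - u N‖ := by
          gcongr
          linarith [le_abs_self c]
        _ < (|c| + 1) * (ε / (|c| + 1)) := by gcongr
        _ = ε := by field_simp
    obtain ⟨b, hb⟩ := cauchySeq_tendsto_of_complete hcau
    have hmem : (b, a + z • b) ∈ (mul A G).graph := by
      refine hclosed.mem_of_tendsto (hb.prodMk_nhds (hua.add (hb.const_smul z)))
        (Eventually.of_forall fun n => ?_)
      have := hL (y n)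
      rwa [hy'] at this
    refine ⟨a + z • b - l • b, ?_⟩
    have := hR.apply_eq hmem
    change L _ = a
    rw [hLapp, this]
    module
  have htop : LinearMap.range (L : H →ₗ[ℂ] H) = ⊤ := by
    have : CompleteSpace (LinearMap.range (L : H →ₗ[ℂ] H)) := hrange.completeSpace_coe
    rw [← Submodule.orthogonal_eq_bot_iff, Submodule.eq_bot_iff]
    intro y hy
    have hy0 : ∀ w, inner ℂ (L w) y = 0 := fun w =>
      (Submodule.mem_orthogonal _ _).1 hy _ ⟨w, rfl⟩
    have h1 : (y, star z • y) ∈ (mul G A).graph := by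
      rw [isResolventAt_iff.1 hadj]
      refine ext_inner_left ℂ fun w => ?_
      have := hy0 w
      simp only [L, add_apply, one_apply_eq_self, smul_apply, inner_add_left,
        inner_smul_left, map_sub] at this
      rw [ContinuousLinearMap.adjoint_inner_right, inner_sub_right, inner_smul_right,
        inner_smul_right, eq_comm, ← sub_eq_zero, ← this]
      simp only [Complex.star_def]
      ring
    obtain ⟨w, h2, h3⟩ := mem_graph_mul.1 h1
    have hw : w = 0 := hinj w (mem_graph_mul.2 ⟨_, h3, A.graph.smul_mem (star z) h2⟩)
    rw [hw] at h3
    exact (smul_eq_zero.1 (G.graph_fst_eq_zero_snd h3 rfl)).resolve_left (star_ne_zero.2 hz)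
  intro y
  obtain ⟨w, hw⟩ : y ∈ LinearMap.range (L : H →ₗ[ℂ] H) := htop ▸ Submodule.mem_top
  have hw' : L w = y := hw
  exact ⟨R w, hw' ▸ hL w⟩

end Products

/-! ### Estimates for bounded operators -/

section BoundedEstimates

variable {H : Type*} [NormedAddCommGroup H] [InnerProductSpace ℂ H]

theorem norm_pow_apply_le {X : H →L[ℂ] H} {M : ℝ} (hX : ‖X‖ ≤ M) (k : ℕ) (x : H) :
    ‖(X ^ k) x‖ ≤ M ^ k * ‖x‖ := by
  have hM : 0 ≤ M := (norm_nonneg X).trans hX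
  induction k with
  | zero => simp
  | succ k ih =>
    rw [pow_succ', mul_apply_eq_comp, pow_succ', mul_assoc]
    exact (X.le_of_opNorm_le hX _).trans (mul_le_mul_of_nonneg_left ih hM)

theorem norm_pow_apply_sub_pow_apply_le {X Y : H →L[ℂ] H} (h : Commute X Y) {M : ℝ}
    (hM : 1 ≤ M) (hX : ‖X‖ ≤ M) (hY : ‖Y‖ ≤ M) (k : ℕ) (x : H) :
    ‖(X ^ k) x - (Y ^ k) x‖ ≤ k * M ^ k * ‖X x - Y x‖ := by
  induction k with
  | zero => simp
  | succ k ih =>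
    have hsplit : (X ^ (k + 1)) x - (Y ^ (k + 1)) x =
        X ((X ^ k) x - (Y ^ k) x) + (Y ^ k) (X x - Y x) := by
      have := congrArg (fun Z : H →L[ℂ] H => Z x) (h.pow_right k).eq
      simp only [mul_apply_eq_comp] at this
      rw [pow_succ' X, pow_succ Y, mul_apply_eq_comp, mul_apply_eq_comp, map_sub, map_sub, this]
      abel
    rw [hsplit]
    have h1 := (X.le_of_opNorm_le hX ((X ^ k) x - (Y ^ k) x)).trans
      (mul_le_mul_of_nonneg_left ih (by linarith))
    have h2 := norm_pow_apply_le hY k (X x - Y x)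
    have h3 : M ^ k * ‖X x - Y x‖ ≤ M ^ (k + 1) * ‖X x - Y x‖ := by
      exact mul_le_mul_of_nonneg_right (pow_le_pow_right₀ hM k.le_succ) (norm_nonneg _)
    refine (norm_add_le _ _).trans ((add_le_add h1 (h2.trans h3)).trans (le_of_eq ?_))
    push_cast
    ring

/-- Cauchy-Schwarz inequality for the semi-definite form of a positive operator. -/
theorem exists_norm_sq_le_of_isPositive [CompleteSpace H] {K : H →L[ℂ] H} (hK : K.IsPositive) :
    ∃ c : ℝ, 0 ≤ c ∧ ∀ x, ‖K x‖ ^ 2 ≤ c * (inner ℂ x (K x)).re := by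
  obtain ⟨Q, rfl⟩ := CStarAlgebra.nonneg_iff_eq_star_mul_self.1
    ((ContinuousLinearMap.nonneg_iff_isPositive K).2 hK)
  refine ⟨‖star Q‖ ^ 2, by positivity, fun x => ?_⟩
  have h1 : (inner ℂ x ((star Q * Q) x)).re = ‖Q x‖ ^ 2 := by
    rw [mul_apply_eq_comp, ContinuousLinearMap.star_eq_adjoint,
      ContinuousLinearMap.adjoint_inner_right]
    exact inner_self_eq_norm_sq (𝕜 := ℂ) (Q x)
  rw [h1, ← mul_pow]
  gcongr
  exact (star Q).le_opNorm _

/-- For a resolvent `S = (T - l̄)⁻¹`, the bounded operator that represents `p(T) S ^ (d + 1)`, where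
`d` is the degree of `p`; here `1 + l̄ S` stands for `T S`. -/
noncomputable def boundedPoly (p : Polynomial ℝ) (l : ℂ) (S : H →L[ℂ] H) : H →L[ℂ] H :=
  ∑ k ∈ Finset.range (p.natDegree + 1),
    ((p.coeff k : ℝ) : ℂ) • (S ^ (p.natDegree + 1 - k) * (1 + star l • S) ^ k)

theorem commute_one_add_smul (l : ℂ) (S : H →L[ℂ] H) : Commute (1 + l • S) S :=
  (Commute.one_left S).add_left ((Commute.refl S).smul_left l)

theorem exists_norm_boundedPoly_sub_le (p : Polynomial ℝ) (l : ℂ) (S : H →L[ℂ] H) (r : ℝ) :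
    ∃ c : ℝ, 0 ≤ c ∧ ∀ μ : ℂ, ‖μ‖ ≤ r → ∀ x : H,
      ‖boundedPoly p l S x - Polynomial.aeval μ p • (S ^ (p.natDegree + 1)) x‖ ≤
        c * ‖x - (μ - star l) • S x‖ := by
  let W : H →L[ℂ] H := 1 + star l • S
  let M : ℝ := 1 + ‖W‖ + |r| * ‖S‖
  have hrS : 0 ≤ |r| * ‖S‖ := by positivity
  have hM : 1 ≤ M := by linarith [norm_nonneg W]
  refine ⟨∑ k ∈ Finset.range (p.natDegree + 1),
    |p.coeff k| * (‖S ^ (p.natDegree + 1 - k)‖ * (k * M ^ k)), by positivity, fun μ hμ x => ?_⟩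
  have hY : ‖μ • S‖ ≤ M := by
    rw [norm_smul]
    have : ‖μ‖ * ‖S‖ ≤ |r| * ‖S‖ := by
      gcongr
      exact hμ.trans (le_abs_self r)
    linarith [norm_nonneg W]
  have hX : ‖W‖ ≤ M := by linarith
  have hcomm : Commute W (μ • S) := (commute_one_add_smul (star l) S).smul_right μ
  have hg : W x - (μ • S) x = x - (μ - star l) • S x := by
    simp only [W, add_apply, one_apply_eq_self, smul_apply, sub_smul]
    abel
  have hterm : boundedPoly p l S x - Polynomial.aeval μ p • (S ^ (p.natDegree + 1)) x =
      ∑ k ∈ Finset.range (p.natDegree + 1), ((p.coeff k : ℝ) : ℂ) •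
        (S ^ (p.natDegree + 1 - k)) ((W ^ k) x - ((μ • S) ^ k) x) := by
    rw [boundedPoly, Polynomial.aeval_eq_sum_range, Finset.sum_smul, sum_apply,
      ← Finset.sum_sub_distrib]
    refine Finset.sum_congr rfl fun k hk => ?_
    have hk' : p.natDegree + 1 = (p.natDegree + 1 - k) + k := by
      have := Finset.mem_range.1 hk
      omega
    have hS : (S ^ (p.natDegree + 1)) x = (S ^ (p.natDegree + 1 - k)) ((S ^ k) x) := by
      conv_lhs => rw [hk', pow_add, mul_apply_eq_comp]
    rw [hS, map_sub, smul_pow, smul_apply, smul_apply, mul_apply_eq_comp, map_smul, smul_sub,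
      smul_smul, Complex.real_smul]
  rw [hterm, Finset.sum_mul, ← hg]
  refine norm_sum_le_of_le _ fun k _ => ?_
  rw [norm_smul, Complex.norm_real, Real.norm_eq_abs, mul_assoc, mul_assoc]
  gcongr
  exact ((S ^ (p.natDegree + 1 - k)).le_opNorm _).trans (mul_le_mul_of_nonneg_left
    (norm_pow_apply_sub_pow_apply_le hcomm hM hX hY k x) (norm_nonneg _))

theorem exists_norm_sub_smul_pow_le (l : ℂ) (S : H →L[ℂ] H) (r : ℝ) (k : ℕ) :
    ∃ c : ℝ, 0 ≤ c ∧ ∀ μ : ℂ, ‖μ‖ ≤ r → ∀ x : H,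
      ‖x - (μ - star l) ^ k • (S ^ k) x‖ ≤ c * ‖x - (μ - star l) • S x‖ := by
  let I : H →L[ℂ] H := 1
  let M : ℝ := 1 + ‖I‖ + (|r| + ‖l‖) * ‖S‖
  have hrS : 0 ≤ (|r| + ‖l‖) * ‖S‖ := by positivity
  have hM : 1 ≤ M := by linarith [norm_nonneg I]
  refine ⟨k * M ^ k, by positivity, fun μ hμ x => ?_⟩
  have hY : ‖(μ - star l) • S‖ ≤ M := by
    rw [norm_smul]
    have : ‖μ - star l‖ * ‖S‖ ≤ (|r| + ‖l‖) * ‖S‖ := by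
      gcongr
      refine (norm_sub_le _ _).trans (add_le_add (hμ.trans (le_abs_self r)) ?_)
      rw [norm_star]
    linarith [norm_nonneg I]
  have hX : ‖I‖ ≤ M := by linarith
  have := norm_pow_apply_sub_pow_apply_le (Commute.one_left ((μ - star l) • S)) hM hX hY k x
  simpa [smul_pow] using this

theorem exists_norm_aeval_le (p : Polynomial ℝ) (r : ℝ) :
    ∃ c : ℝ, 0 ≤ c ∧ ∀ μ : ℂ, ‖μ‖ ≤ r → ‖Polynomial.aeval μ p‖ ≤ c := by
  obtain ⟨c, hc⟩ := (isCompact_closedBall (0 : ℂ) r).exists_bound_of_continuousOn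
    (f := fun μ : ℂ => Polynomial.aeval μ p) (by fun_prop)
  exact ⟨|c|, abs_nonneg c, fun μ hμ => (hc μ (by simpa using hμ)).trans (le_abs_self c)⟩

variable [CompleteSpace H]

/-- Positivity of `(p(T) y, G y)` for `y = S ^ (d + 1) x` controls a smoothed version of `p(T) y`.
Here `C` stands for `G S` and `P` for `p(T) S ^ (d + 1)`. The Cauchy-Schwarz inequality bounds
`K x`, where `K = (C S ^ d)* P`. By the relations between `C`, `S` and `V` (the Cayley transform),
`C S ^ d P = (V*) ^ (d + 1) K`, and `B` turns the left-hand side into `S ^ (d + 1) T S P`. -/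
theorem exists_norm_sq_le_of_definitizing {l : ℂ} {S C B V : H →L[ℂ] H} (hVS : Commute V S)
    (hC : ContinuousLinearMap.adjoint C = C * V)
    (hSC : ContinuousLinearMap.adjoint S * C = C * V * S)
    (hBC : B * C = S * (1 + star l • S)) {P : H →L[ℂ] H} {d : ℕ}
    (hpos : ∀ x, 0 ≤ inner ℂ (C ((S ^ d) x)) (P x)) :
    ∃ c : ℝ, 0 < c ∧ ∀ x, ‖(S ^ (d + 1) * (1 + star l • S)) (P x)‖ ^ 2 ≤
      c * (inner ℂ (C ((S ^ d) x)) (P x)).re := by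
  have hD : ContinuousLinearMap.adjoint (C * S ^ d) = C * S ^ d * V ^ (d + 1) := by
    have hind : ∀ n : ℕ, (ContinuousLinearMap.adjoint S) ^ n * C = C * V ^ n * S ^ n := by
      intro n
      induction n with
      | zero => simp
      | succ n ih =>
        rw [pow_succ', mul_assoc, ih, ← mul_assoc, ← mul_assoc, hSC, pow_succ' V, pow_succ' S]
        simp only [mul_assoc]
        rw [← mul_assoc S, ((hVS.pow_left n).eq).symm]
        simp only [mul_assoc]
    rw [← ContinuousLinearMap.star_eq_adjoint, star_mul, star_pow,
      ContinuousLinearMap.star_eq_adjoint, ContinuousLinearMap.star_eq_adjoint, hC, ← mul_assoc,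
      hind, mul_assoc C, (hVS.pow_pow d d).eq, pow_succ]
    simp only [mul_assoc]
  set D := C * S ^ d with hDdef
  have hK : (ContinuousLinearMap.adjoint D * P).IsPositive := by
    rw [ContinuousLinearMap.isPositive_iff_complex]
    intro x
    have h1 : inner ℂ ((ContinuousLinearMap.adjoint D * P) x) x = inner ℂ (P x) (D x) := by
      rw [mul_apply_eq_comp, ContinuousLinearMap.adjoint_inner_left]
    have h2 : 0 ≤ inner ℂ (P x) (D x) := by
      have := star_nonneg_iff.2 (hpos x)
      rwa [Complex.star_def, inner_conj_symm] at this
    rw [h1]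
    exact ⟨(Complex.eq_re_of_ofReal_le h2).symm, (Complex.nonneg_iff.1 h2).1⟩
  obtain ⟨c, hc, hK'⟩ := exists_norm_sq_le_of_isPositive hK
  have hBD : S ^ (d + 1) * (1 + star l • S) = B * star (V ^ (d + 1)) * star D := by
    have h1 : B * D = S ^ (d + 1) * (1 + star l • S) := by
      rw [hDdef, ← mul_assoc, hBC, mul_assoc, ((commute_one_add_smul (star l) S).pow_right d).eq,
        ← mul_assoc, ← pow_succ']
    rw [← h1, mul_assoc, ← star_mul, ← hD, ContinuousLinearMap.star_eq_adjoint,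
      ContinuousLinearMap.adjoint_adjoint]
  refine ⟨‖B * star (V ^ (d + 1))‖ ^ 2 * c + 1, by positivity, fun x => ?_⟩
  have h0 : 0 ≤ (inner ℂ (C ((S ^ d) x)) (P x)).re := (Complex.nonneg_iff.1 (hpos x)).1
  have h1 : inner ℂ x ((ContinuousLinearMap.adjoint D * P) x) =
      inner ℂ (C ((S ^ d) x)) (P x) := by
    rw [mul_apply_eq_comp, ContinuousLinearMap.adjoint_inner_right, hDdef, mul_apply_eq_comp]
  have h2 := hK' x
  rw [h1] at h2
  have h3 : ‖(S ^ (d + 1) * (1 + star l • S)) (P x)‖ ≤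
      ‖B * star (V ^ (d + 1))‖ * ‖(ContinuousLinearMap.adjoint D * P) x‖ := by
    rw [hBD, mul_apply_eq_comp, mul_apply_eq_comp (ContinuousLinearMap.adjoint D),
      ContinuousLinearMap.star_eq_adjoint D]
    exact ContinuousLinearMap.le_opNorm _ _
  calc _ ≤ (‖B * star (V ^ (d + 1))‖ * ‖(ContinuousLinearMap.adjoint D * P) x‖) ^ 2 := by gcongr
    _ ≤ ‖B * star (V ^ (d + 1))‖ ^ 2 * (c * (inner ℂ (C ((S ^ d) x)) (P x)).re) := by
      rw [mul_pow]
      gcongr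
    _ ≤ _ := by linarith

/-- The key estimate: `‖μ p(μ)‖² ‖x‖²` is bounded, up to the defect `x - (μ - l̄) S x = S (T - μ) x`,
by the indefinite square of `S ^ (d + 1) x` multiplied by `p(μ)`, locally uniformly in `μ`. -/
theorem exists_norm_sq_le_of_definitizing_poly {l : ℂ} {S C B V : H →L[ℂ] H} (hVS : Commute V S)
    (hC : ContinuousLinearMap.adjoint C = C * V)
    (hSC : ContinuousLinearMap.adjoint S * C = C * V * S)
    (hBC : B * C = S * (1 + star l • S)) {p : Polynomial ℝ}
    (hpos : ∀ x, 0 ≤ inner ℂ (C ((S ^ p.natDegree) x)) (boundedPoly p l S x)) (r : ℝ) :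
    ∃ c c' : ℝ, 0 < c ∧ 0 ≤ c' ∧ ∀ μ : ℂ, ‖μ‖ ≤ r → ∀ x : H,
      ‖μ * Polynomial.aeval μ p‖ ^ 2 * ‖x‖ ^ 2 ≤
        c * (Polynomial.aeval μ p *
          inner ℂ (C ((S ^ p.natDegree) x)) (S ((S ^ p.natDegree) x))).re +
        c' * (‖x - (μ - star l) • S x‖ * ‖x‖) := by
  set d := p.natDegree with hd
  set W : H →L[ℂ] H := 1 + star l • S with hW
  obtain ⟨a, ha, haP⟩ := exists_norm_sq_le_of_definitizing hVS hC hSC hBC hpos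
  obtain ⟨e, he, heP⟩ := exists_norm_boundedPoly_sub_le p l S r
  obtain ⟨b, hb, hbS⟩ := exists_norm_sub_smul_pow_le l S r (2 * d + 3)
  obtain ⟨q, hq, hqp⟩ := exists_norm_aeval_le p r
  -- `f` bounds `|μ - l̄| ^ (2 d + 3)`, `g` bounds the defect by `‖x‖`
  set f : ℝ := (|r| + ‖l‖) ^ (2 * d + 3) with hf
  set g : ℝ := 1 + (|r| + ‖l‖) * ‖S‖ with hg
  set u : ℝ := q * ‖S ^ (d + 1) * S ^ (d + 1)‖ + ‖S ^ (d + 1) * W‖ * e with hu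
  set v : ℝ := |r| * q * b + f * u with hv
  have hf0 : 0 ≤ f := by positivity
  have hu0 : 0 ≤ u := by positivity
  have hv0 : 0 ≤ v := by positivity
  have hg0 : 0 ≤ g := by positivity
  refine ⟨2 * (f ^ 2 + 1) * a, 2 * (f ^ 2 + 1) * a * (‖C * S ^ d‖ * e) + 2 * v ^ 2 * g,
    by positivity, by positivity, fun μ hμ x => ?_⟩
  set γ := ‖x - (μ - star l) • S x‖ with hγ
  have hγ0 : 0 ≤ γ := norm_nonneg _
  have hμl : ‖μ - star l‖ ≤ |r| + ‖l‖ := by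
    refine (norm_sub_le _ _).trans (add_le_add (hμ.trans (le_abs_self r)) ?_)
    rw [norm_star]
  set y := x - (μ - star l) • S x with hy
  set E := boundedPoly p l S x - Polynomial.aeval μ p • (S ^ (d + 1)) x with hE
  have hEγ : ‖E‖ ≤ e * γ := heP μ hμ x
  set N := (S ^ (d + 1) * W) (boundedPoly p l S x) with hN
  have hNsplit : N = (μ * Polynomial.aeval μ p) • (S ^ (2 * d + 3)) x +
      (Polynomial.aeval μ p • (S ^ (d + 1) * S ^ (d + 1)) y + (S ^ (d + 1) * W) E) := by
    have hP : boundedPoly p l S x = Polynomial.aeval μ p • (S ^ (d + 1)) x + E := by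
      rw [hE]
      abel
    have hWx : W x = μ • S x + y := by
      rw [hy, hW, add_apply, one_apply_eq_self, smul_apply]
      module
    have hcomm : W ((S ^ (d + 1)) x) = (S ^ (d + 1)) (W x) := by
      have := ((commute_one_add_smul (star l) S).pow_right (d + 1)).eq
      rw [← mul_apply_eq_comp, ← mul_apply_eq_comp, this]
    have hpow : (S ^ (d + 1)) ((S ^ (d + 1)) (S x)) = (S ^ (2 * d + 3)) x := by
      rw [← mul_apply_eq_comp, ← mul_apply_eq_comp, ← pow_add, ← pow_succ]
      congr 2
      omega
    rw [hN, hP, map_add, map_smul, mul_apply_eq_comp, hcomm, hWx]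
    simp only [map_add, map_smul, smul_add, smul_smul, hpow, mul_apply_eq_comp]
    rw [mul_comm μ]
    abel
  have hSn : ‖μ * Polynomial.aeval μ p‖ * ‖(S ^ (2 * d + 3)) x‖ ≤ ‖N‖ + u * γ := by
    have h1 : ‖Polynomial.aeval μ p • (S ^ (d + 1) * S ^ (d + 1)) y + (S ^ (d + 1) * W) E‖ ≤
        u * γ := by
      refine (norm_add_le_of_le (r₁ := q * (‖S ^ (d + 1) * S ^ (d + 1)‖ * γ))
        (r₂ := ‖S ^ (d + 1) * W‖ * (e * γ)) ?_ ?_).trans (le_of_eq (by rw [hu]; ring))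
      · rw [norm_smul]
        exact mul_le_mul (hqp μ hμ) (ContinuousLinearMap.le_opNorm _ _) (norm_nonneg _) hq
      · exact (ContinuousLinearMap.le_opNorm _ _).trans (by gcongr)
    rw [← norm_smul, eq_sub_of_add_eq hNsplit.symm]
    exact (norm_sub_le _ _).trans (by gcongr)
  have hx : ‖μ * Polynomial.aeval μ p‖ * ‖x‖ ≤ f * ‖N‖ + v * γ := by
    have h1 : ‖x‖ ≤ b * γ + f * ‖(S ^ (2 * d + 3)) x‖ := by
      have h2 := hbS μ hμ x
      have h3 : ‖(μ - star l) ^ (2 * d + 3) • (S ^ (2 * d + 3)) x‖ ≤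
          f * ‖(S ^ (2 * d + 3)) x‖ := by
        rw [norm_smul, norm_pow, hf]
        gcongr
      have h4 := norm_add_le (x - (μ - star l) ^ (2 * d + 3) • (S ^ (2 * d + 3)) x)
        ((μ - star l) ^ (2 * d + 3) • (S ^ (2 * d + 3)) x)
      rw [sub_add_cancel] at h4
      exact h4.trans (add_le_add h2 h3)
    have h5 : ‖μ * Polynomial.aeval μ p‖ ≤ |r| * q := by
      rw [norm_mul]
      exact mul_le_mul (hμ.trans (le_abs_self r)) (hqp μ hμ) (norm_nonneg _) (abs_nonneg r)
    calc ‖μ * Polynomial.aeval μ p‖ * ‖x‖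
        ≤ ‖μ * Polynomial.aeval μ p‖ * (b * γ + f * ‖(S ^ (2 * d + 3)) x‖) := by gcongr
      _ = ‖μ * Polynomial.aeval μ p‖ * (b * γ) +
          f * (‖μ * Polynomial.aeval μ p‖ * ‖(S ^ (2 * d + 3)) x‖) := by ring
      _ ≤ |r| * q * (b * γ) + f * (‖N‖ + u * γ) := by gcongr
      _ = f * ‖N‖ + v * γ := by rw [hv]; ring
  have hγx : γ ≤ g * ‖x‖ := by
    have h1 : ‖(μ - star l) • S x‖ ≤ (|r| + ‖l‖) * (‖S‖ * ‖x‖) := by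
      rw [norm_smul]
      exact mul_le_mul hμl (S.le_opNorm x) (norm_nonneg _) (by positivity)
    refine (norm_sub_le _ _).trans ((add_le_add_right h1 _).trans (le_of_eq ?_))
    rw [hg]
    ring
  set s := inner ℂ (C ((S ^ d) x)) (S ((S ^ d) x)) with hs
  set h := (inner ℂ (C ((S ^ d) x)) (boundedPoly p l S x)).re with hh
  have hh0 : 0 ≤ h := (Complex.nonneg_iff.1 (hpos x)).1
  have hN2 : ‖N‖ ^ 2 ≤ a * h := haP x
  have hhs : h ≤ (Polynomial.aeval μ p * s).re + ‖C * S ^ d‖ * e * (γ * ‖x‖) := by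
    have hP : boundedPoly p l S x = Polynomial.aeval μ p • S ((S ^ d) x) + E := by
      rw [hE, pow_succ' S d, mul_apply_eq_comp]
      abel
    rw [hh, hP, inner_add_right, inner_smul_right, Complex.add_re]
    have h1 : (inner ℂ (C ((S ^ d) x)) E).re ≤ ‖C * S ^ d‖ * ‖x‖ * (e * γ) := by
      refine (Complex.re_le_norm _).trans ((norm_inner_le_norm _ _).trans ?_)
      exact mul_le_mul ((C * S ^ d).le_opNorm x) hEγ (norm_nonneg _) (by positivity)
    linarith
  calc ‖μ * Polynomial.aeval μ p‖ ^ 2 * ‖x‖ ^ 2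
      = (‖μ * Polynomial.aeval μ p‖ * ‖x‖) ^ 2 := by ring
    _ ≤ (f * ‖N‖ + v * γ) ^ 2 := by gcongr
    _ ≤ 2 * f ^ 2 * ‖N‖ ^ 2 + 2 * v ^ 2 * (γ * γ) := by
      linarith [sq_nonneg (f * ‖N‖ - v * γ)]
    _ ≤ 2 * (f ^ 2 + 1) * (a * h) + 2 * v ^ 2 * (γ * (g * ‖x‖)) := by
      gcongr
      linarith
    _ ≤ 2 * (f ^ 2 + 1) * (a * ((Polynomial.aeval μ p * s).re +
        ‖C * S ^ d‖ * e * (γ * ‖x‖))) + 2 * v ^ 2 * (γ * (g * ‖x‖)) := by gcongr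
    _ = _ := by ring

omit [CompleteSpace H] in
/-- Off the real axis the indefinite square `(G y, y)`, `y = S ^ (d + 1) x`,
is itself controlled by the defect, since both `(G y, y)` and `(G y, T y)` are real. -/
theorem abs_im_mul_norm_inner_le {l : ℂ} {S C : H →L[ℂ] H} (d : ℕ)
    (h1 : ∀ y, (inner ℂ (C y) (S y)).im = 0)
    (h2 : ∀ y, (inner ℂ (C y) ((1 + star l • S) y)).im = 0) (μ : ℂ) (x : H) :
    |μ.im| * ‖inner ℂ (C ((S ^ d) x)) (S ((S ^ d) x))‖ ≤
      ‖C * S ^ d‖ * ‖S ^ d‖ * (‖x - (μ - star l) • S x‖ * ‖x‖) := by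
  set g := x - (μ - star l) • S x with hg
  set s := inner ℂ (C ((S ^ d) x)) (S ((S ^ d) x)) with hs
  have hsplit : (1 + star l • S) ((S ^ d) x) = μ • S ((S ^ d) x) + (S ^ d) g := by
    have hcomm : (S ^ d) (S x) = S ((S ^ d) x) := by
      rw [← mul_apply_eq_comp, ← mul_apply_eq_comp, ← pow_succ, pow_succ']
    rw [hg, map_sub, map_smul, hcomm, add_apply, one_apply_eq_self, smul_apply]
    module
  have h3 := h2 ((S ^ d) x)
  rw [hsplit, inner_add_right, inner_smul_right, Complex.add_im, Complex.mul_im, h1 ((S ^ d) x),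
    mul_zero, zero_add] at h3
  have h4 : ‖s‖ = |s.re| := by
    have : s = (s.re : ℂ) := Complex.ext rfl (h1 ((S ^ d) x))
    rw [this, Complex.norm_real, Complex.ofReal_re, Real.norm_eq_abs]
  rw [h4, ← abs_mul, eq_neg_of_add_eq_zero_left h3, abs_neg]
  refine (Complex.abs_im_le_norm _).trans ((norm_inner_le_norm _ _).trans ?_)
  calc _ ≤ (‖C * S ^ d‖ * ‖x‖) * (‖S ^ d‖ * ‖g‖) :=
        mul_le_mul ((C * S ^ d).le_opNorm x) ((S ^ d).le_opNorm g) (norm_nonneg _) (by positivity)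
    _ = _ := by ring

end BoundedEstimates

/-! ### Factorization of the resolvents and the definitizing form -/

section Factorization

variable {H : Type*} [NormedAddCommGroup H] [InnerProductSpace ℂ H] [CompleteSpace H]

/-- The bounded operators attached to a pair `(A, G)` and a point `l` such that `l` and `l̄` lie in
the resolvent set of `AG`: the resolvents `R = (AG - l)⁻¹` and `S = (AG - l̄)⁻¹`, the products
`CR = G R`, `CS = G S` and `B = A (GA - l̄)⁻¹`, and `V = (AG - l̄)(AG - l)⁻¹`. -/
structure ResolventData (A G : H →ₗ.[ℂ] H) (l : ℂ) where
  /-- The resolvent `(AG - l)⁻¹`. -/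
  R : H →L[ℂ] H
  /-- The resolvent `(AG - l̄)⁻¹`. -/
  S : H →L[ℂ] H
  /-- The product `G (AG - l)⁻¹`. -/
  CR : H →L[ℂ] H
  /-- The product `G (AG - l̄)⁻¹`. -/
  CS : H →L[ℂ] H
  /-- The product `A (GA - l̄)⁻¹`. -/
  B : H →L[ℂ] H
  /-- The Cayley transform `(AG - l̄)(AG - l)⁻¹`. -/
  V : H →L[ℂ] H
  isResolventAt_R : IsResolventAt (mul A G) l R
  isResolventAt_S : IsResolventAt (mul A G) (star l) S
  mem_graph_CR : ∀ y, (R y, CR y) ∈ G.graph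
  mem_graph_CS : ∀ y, (S y, CS y) ∈ G.graph
  mem_graph_one_add : ∀ y, (CS y, (1 + star l • S) y) ∈ A.graph
  adjoint_CS : ContinuousLinearMap.adjoint CS = CR
  CR_eq : CR = CS * V
  commute_V_S : Commute V S
  adjoint_S_mul_CS : ContinuousLinearMap.adjoint S * CS = CR * S
  B_mul_CS : B * CS = S * (1 + star l • S)

variable {A G : H →ₗ.[ℂ] H}

theorem nonempty_resolventData (hA : IsSelfAdjoint A) (hG : IsSelfAdjoint G)
    (hAG : (resolventSet (mul A G)).Nonempty) (hGA : (resolventSet (mul G A)).Nonempty)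
    {l : ℂ} (hl : l ≠ 0) (h : l ∈ resolventSet (mul A G)) : Nonempty (ResolventData A G l) := by
  obtain ⟨S, hS⟩ := star_mem_resolventSet_mul hA hG hAG hGA hl h
  obtain ⟨S', hS'⟩ := mem_resolventSet_mul_swap hGA (star_ne_zero.2 hl) ⟨S, hS⟩
  obtain ⟨R, hR⟩ := h
  have hadj := hS.adjoint_mul hA hG hS'
  rw [star_star] at hadj
  obtain ⟨CR, hCR⟩ := hR.exists_comp hG.isClosed
  obtain ⟨CS, hCS⟩ := hS.exists_comp hG.isClosed
  obtain ⟨B, hB⟩ := hS'.exists_comp hA.isClosed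
  let V : H →L[ℂ] H := 1 + (l - star l) • R
  have hRV : R = S * V := hR.comp_one_add hS
  have hRS : Commute R S := hR.commute hS
  have hCS_adj : ContinuousLinearMap.adjoint CS = CR := by
    refine ContinuousLinearMap.ext fun y => ext_inner_left ℂ fun x => ?_
    rw [ContinuousLinearMap.adjoint_inner_right]
    have hcont1 : Continuous fun y : H => inner ℂ (CS x) y := by fun_prop
    have hcont2 : Continuous fun y : H => inner ℂ x (CR y) := by fun_prop
    refine congrFun (hcont1.ext_on hG.dense_domain hcont2 fun y hy => ?_) y
    have hy' : (y, G ⟨y, hy⟩) ∈ G.graph := G.mem_graph ⟨y, hy⟩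
    change inner ℂ (CS x) y = inner ℂ x (CR y)
    rw [inner_eq_of_isSelfAdjoint hG (hCS x).1 hy', ← ContinuousLinearMap.adjoint_inner_right,
      G.mem_graph_snd_inj (hCR y).1 (hR.intertwine hadj hy') rfl]
  refine ⟨⟨R, S, CR, CS, B, V, hR, hS, fun y => (hCR y).1, fun y => (hCS y).1,
    fun y => (hCS y).2, hCS_adj, ?_, ?_, ?_, ?_⟩⟩
  · ext y
    have h1 := (hCR y).1
    rw [hRV] at h1
    exact G.mem_graph_snd_inj h1 (hCS (V y)).1 rfl
  · exact (Commute.one_left S).add_left (hRS.smul_left _)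
  · ext y
    exact G.mem_graph_snd_inj (hR.intertwine hadj (hCS y).1) (hCR (S y)).1 rfl
  · ext y
    exact A.mem_graph_snd_inj (hB (CS y)).1 (hS'.intertwine hS (hCS y).2) rfl

omit [CompleteSpace H] in
/-- `T ^ k (T - ν)^{-(n + k)} = (T - ν)^{-n} (T (T - ν)⁻¹) ^ k`. -/
theorem IsResolventAt.mem_graph_pow {T : H →ₗ.[ℂ] H} {ν : ℂ} {S : H →L[ℂ] H}
    (hS : IsResolventAt T ν S) (x : H) (n k : ℕ) :
    ((S ^ (n + k)) x, (S ^ n * (1 + ν • S) ^ k) x) ∈ (pow T k).graph := by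
  induction k generalizing n with
  | zero =>
    rw [add_zero, pow_zero, mul_one]
    exact (LinearPMap.mem_graph_iff _).2 ⟨⟨_, Submodule.mem_top⟩, rfl, rfl⟩
  | succ k ih =>
    refine mem_graph_mul.2 ⟨(S ^ (n + 1) * (1 + ν • S) ^ k) x, ?_, ?_⟩
    · rw [← add_assoc, add_right_comm]
      exact ih (n + 1)
    · have h1 : (S ^ (n + 1) * (1 + ν • S) ^ k) x = S ((S ^ n * (1 + ν • S) ^ k) x) := by
        rw [pow_succ', mul_assoc, mul_apply_eq_comp]
      have h2 : (S ^ n * (1 + ν • S) ^ (k + 1)) x =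
          (1 + ν • S) ((S ^ n * (1 + ν • S) ^ k) x) := by
        rw [← mul_apply_eq_comp, ← mul_assoc, ((commute_one_add_smul ν S).pow_right n).eq,
          mul_assoc, ← pow_succ']
      rw [h1, h2]
      exact hS.mem_graph _

theorem ResolventData.inner_nonneg_of_isDefinitizing {l : ℂ} (D : ResolventData A G l)
    {p : Polynomial ℝ} (hp : IsDefinitizing A G p) (x : H) :
    0 ≤ inner ℂ (D.CS ((D.S ^ p.natDegree) x)) (boundedPoly p l D.S x) := by
  set d := p.natDegree with hd
  have hk : ∀ k ≤ d + 1, ((D.S ^ (d + 1)) x, (D.S ^ (d + 1 - k) * (1 + star l • D.S) ^ k) x) ∈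
      (pow (mul A G) k).graph := by
    intro k hk
    have := D.isResolventAt_S.mem_graph_pow x (d + 1 - k) k
    rwa [Nat.sub_add_cancel hk] at this
  have hx : (D.S ^ (d + 1)) x ∈ (pow (mul A G) (max 1 p.natDegree)).domain :=
    LinearPMap.mem_domain_of_mem_graph (hk _ (by omega))
  have h := hp.2 ⟨_, hx⟩
  have h1 : ∀ (f : H →ₗ.[ℂ] H) (y z : H) (hy : y ∈ f.domain), (y, z) ∈ f.graph →
      f ⟨y, hy⟩ = z := fun f y z hy hyz => f.mem_graph_snd_inj (f.mem_graph ⟨y, hy⟩) hyz rfl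
  have hG : ((D.S ^ (d + 1)) x, D.CS ((D.S ^ d) x)) ∈ G.graph := by
    rw [pow_succ', mul_apply_eq_comp]
    exact D.mem_graph_CS _
  rw [h1 G _ _ _ hG, polyOp_apply] at h
  convert h using 2
  rw [boundedPoly, ← Fin.sum_univ_eq_sum_range (fun k => ((p.coeff k : ℝ) : ℂ) •
    (D.S ^ (p.natDegree + 1 - k) * (1 + star l • D.S) ^ k)), sum_apply]
  refine Finset.sum_congr rfl fun k _ => ?_
  rw [smul_apply]
  congr 1
  exact (h1 _ _ _ _ (hk k (by omega))).symm

theorem ResolventData.inner_im_eq_zero (hG : IsSelfAdjoint G) {l : ℂ} (D : ResolventData A G l)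
    (y : H) : (inner ℂ (D.CS y) (D.S y)).im = 0 := by
  rw [← Complex.conj_eq_iff_im, inner_conj_symm]
  exact (inner_eq_of_isSelfAdjoint hG (D.mem_graph_CS y) (D.mem_graph_CS y)).symm

theorem ResolventData.inner_one_add_im_eq_zero (hA : IsSelfAdjoint A) {l : ℂ}
    (D : ResolventData A G l) (y : H) :
    (inner ℂ (D.CS y) ((1 + star l • D.S) y)).im = 0 := by
  rw [← Complex.conj_eq_iff_im, inner_conj_symm]
  exact inner_eq_of_isSelfAdjoint hA (D.mem_graph_one_add y) (D.mem_graph_one_add y)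

omit [CompleteSpace H] in
/-- The defect `x - (μ - ν) S x`, with `S = (T - ν)⁻¹`, is `S (T - μ) x`. -/
theorem IsResolventAt.sub_smul_eq {T : H →ₗ.[ℂ] H} {ν μ : ℂ} {S : H →L[ℂ] H}
    (hS : IsResolventAt T ν S) {x x' : H} (hx : (x, x') ∈ T.graph) :
    x - (μ - ν) • S x = S (x' - μ • x) := by
  conv_lhs => enter [1]; rw [← hS.apply_eq hx]
  simp only [map_sub, map_smul]
  module

theorem ResolventData.exists_norm_sq_le {l : ℂ} (D : ResolventData A G l)
    {p : Polynomial ℝ} (hp : IsDefinitizing A G p) (r : ℝ) :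
    ∃ c c' : ℝ, 0 < c ∧ 0 ≤ c' ∧ ∀ μ : ℂ, ‖μ‖ ≤ r → ∀ x : H,
      ‖μ * Polynomial.aeval μ p‖ ^ 2 * ‖x‖ ^ 2 ≤
        c * (Polynomial.aeval μ p *
          inner ℂ (D.CS ((D.S ^ p.natDegree) x)) (D.S ((D.S ^ p.natDegree) x))).re +
        c' * (‖x - (μ - star l) • D.S x‖ * ‖x‖) :=
  exists_norm_sq_le_of_definitizing_poly D.commute_V_S (D.adjoint_CS.trans D.CR_eq)
    (by rw [D.adjoint_S_mul_CS, D.CR_eq]) D.B_mul_CS (D.inner_nonneg_of_isDefinitizing hp) r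

/-- Off the real axis and away from the zeros of a definitizing polynomial `p`, the operator
`AG - μ` is bounded below, with a bound that degenerates at most like `p(μ) ^ 2` near the
zeros of `p`. -/
theorem ResolventData.exists_bounded_below (hA : IsSelfAdjoint A) (hG : IsSelfAdjoint G) {l : ℂ}
    (D : ResolventData A G l) {p : Polynomial ℝ} (hp : IsDefinitizing A G p) (r : ℝ) :
    ∃ c : ℝ, 0 ≤ c ∧ ∀ μ : ℂ, ‖μ‖ ≤ r → ∀ x x', (x, x') ∈ (mul A G).graph →
      |μ.im| * ‖μ * Polynomial.aeval μ p‖ ^ 2 * ‖x‖ ≤ c * ‖x' - μ • x‖ := by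
  obtain ⟨c, c', hc, hc', h⟩ := D.exists_norm_sq_le hp r
  obtain ⟨q, hq, hqp⟩ := exists_norm_aeval_le p r
  set K := ‖D.CS * D.S ^ p.natDegree‖ * ‖D.S ^ p.natDegree‖ with hK
  have hK0 : 0 ≤ K := by positivity
  refine ⟨(c * q * K + |r| * c') * ‖D.S‖, by positivity, fun μ hμ x x' hx => ?_⟩
  set s := inner ℂ (D.CS ((D.S ^ p.natDegree) x)) (D.S ((D.S ^ p.natDegree) x)) with hs
  set γ := ‖x - (μ - star l) • D.S x‖ with hγ
  have h1 : |μ.im| * ‖s‖ ≤ K * (γ * ‖x‖) := abs_im_mul_norm_inner_le p.natDegree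
    (D.inner_im_eq_zero hG) (D.inner_one_add_im_eq_zero hA) μ x
  have h2 := h μ hμ x
  have h3 : (Polynomial.aeval μ p * s).re ≤ q * ‖s‖ := by
    refine (Complex.re_le_norm _).trans ?_
    rw [norm_mul]
    gcongr
    exact hqp μ hμ
  have h4 : |μ.im| ≤ |r| := (Complex.abs_im_le_norm μ).trans (hμ.trans (le_abs_self r))
  have h5 : γ ≤ ‖D.S‖ * ‖x' - μ • x‖ := by
    rw [hγ, D.isResolventAt_S.sub_smul_eq hx]
    exact D.S.le_opNorm _
  have hγ0 : 0 ≤ γ := norm_nonneg _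
  have h6 : |μ.im| * ‖μ * Polynomial.aeval μ p‖ ^ 2 * ‖x‖ * ‖x‖ ≤
      (c * q * K + |r| * c') * ‖D.S‖ * ‖x' - μ • x‖ * ‖x‖ := by
    calc _ = |μ.im| * (‖μ * Polynomial.aeval μ p‖ ^ 2 * ‖x‖ ^ 2) := by ring
      _ ≤ |μ.im| * (c * (q * ‖s‖) + c' * (γ * ‖x‖)) := by
        gcongr
        exact h2.trans (by gcongr)
      _ = c * q * (|μ.im| * ‖s‖) + |μ.im| * (c' * (γ * ‖x‖)) := by ring
      _ ≤ c * q * (K * (γ * ‖x‖)) + |r| * (c' * (γ * ‖x‖)) := by gcongr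
      _ = (c * q * K + |r| * c') * γ * ‖x‖ := by ring
      _ ≤ (c * q * K + |r| * c') * (‖D.S‖ * ‖x' - μ • x‖) * ‖x‖ := by gcongr
      _ = _ := by ring
  rcases (norm_nonneg x).eq_or_lt with h0 | h0
  · rw [← h0, mul_zero]
    positivity
  · exact le_of_mul_le_mul_right h6 h0

end Factorization

/-! ### The non-real spectrum -/

section NonrealSpectrum

variable {H : Type*} [NormedAddCommGroup H] [InnerProductSpace ℂ H] [CompleteSpace H]
  {A G : H →ₗ.[ℂ] H}

theorem exists_resolventData (hA : IsSelfAdjoint A) (hG : IsSelfAdjoint G)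
    (hAG : (resolventSet (mul A G)).Nonempty) (hGA : (resolventSet (mul G A)).Nonempty) :
    ∃ l, Nonempty (ResolventData A G l) := by
  obtain ⟨l, hl, hl0⟩ := exists_ne_zero_mem_resolventSet hAG
  exact ⟨l, nonempty_resolventData hA hG hAG hGA hl0 hl⟩

/-- A non-real point `z` with `p(z) ≠ 0` is in the resolvent set: `p` is real, so `AG` is bounded
below at both `z` and `z̄`. -/
theorem mem_resolventSet_of_aeval_ne_zero (hA : IsSelfAdjoint A) (hG : IsSelfAdjoint G)
    (hAG : (resolventSet (mul A G)).Nonempty) (hGA : (resolventSet (mul G A)).Nonempty)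
    {p : Polynomial ℝ} (hp : IsDefinitizing A G p) {z : ℂ} (hz : z.im ≠ 0)
    (hpz : Polynomial.aeval z p ≠ 0) : z ∈ resolventSet (mul A G) := by
  obtain ⟨l, ⟨D⟩⟩ := exists_resolventData hA hG hAG hGA
  have hz0 : z ≠ 0 := fun h => hz (by simp [h])
  have hbelow : ∀ μ : ℂ, μ.im ≠ 0 → Polynomial.aeval μ p ≠ 0 →
      ∃ c : ℝ, ∀ x x', (x, x') ∈ (mul A G).graph → ‖x‖ ≤ c * ‖x' - μ • x‖ := by
    intro μ hμ hpμ
    obtain ⟨c, -, h⟩ := D.exists_bounded_below hA hG hp ‖μ‖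
    have hμ0 : μ ≠ 0 := fun h => hμ (by simp [h])
    have hk : 0 < |μ.im| * ‖μ * Polynomial.aeval μ p‖ ^ 2 :=
      mul_pos (abs_pos.2 hμ) (pow_pos (norm_pos_iff.2 (mul_ne_zero hμ0 hpμ)) 2)
    refine ⟨c / (|μ.im| * ‖μ * Polynomial.aeval μ p‖ ^ 2), fun x x' hx => ?_⟩
    rw [div_mul_eq_mul_div, le_div_iff₀ hk, mul_comm]
    exact h μ le_rfl x x' hx
  obtain ⟨c, hc⟩ := hbelow z hz hpz
  have hpz' : Polynomial.aeval (star z) p ≠ 0 := by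
    rw [Complex.star_def, Polynomial.aeval_conj]
    simpa using hpz
  obtain ⟨c', hc'⟩ := hbelow (star z) (by simpa using hz) hpz'
  exact mem_resolventSet_of_bounded_below hA hG hAG hGA hz0 hc fun y hy => by
    simpa using hc' _ _ hy

/-- A function that is holomorphic and bounded on a punctured neighbourhood is meromorphic. -/
theorem meromorphicAt_of_eventually_norm_le {E : Type*} [NormedAddCommGroup E] [NormedSpace ℂ E]
    [CompleteSpace E] {f : ℂ → E} {z : ℂ} {M : ℝ}
    (hd : ∀ᶠ μ in 𝓝[≠] z, DifferentiableAt ℂ f μ) (hb : ∀ᶠ μ in 𝓝[≠] z, ‖f μ‖ ≤ M) :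
    MeromorphicAt f z := by
  refine ⟨1, Complex.analyticAt_of_differentiable_on_punctured_nhds_of_continuousAt ?_ ?_⟩
  · filter_upwards [hd] with μ hμ
    fun_prop
  · rw [continuousAt_iff_punctured_nhds]
    simp only [sub_self, pow_one, zero_smul]
    have h1 : Tendsto (fun μ : ℂ => μ - z) (𝓝[≠] z) (𝓝 0) := by
      have : Tendsto (fun μ : ℂ => μ - z) (𝓝 z) (𝓝 (z - z)) := Continuous.tendsto (by fun_prop) z
      rw [sub_self] at this
      exact this.mono_left nhdsWithin_le_nhds
    exact h1.zero_smul_isBoundedUnder_le ⟨M, hb⟩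

/-- Near a non-real point `z` of the spectrum, `p ^ 2` times the resolvent is bounded, so that the
resolvent is meromorphic at `z`; its order is negative because a bounded resolvent would put `z`
into the resolvent set. -/
theorem isPoleOfResolvent_of_im_ne_zero (hA : IsSelfAdjoint A) (hG : IsSelfAdjoint G)
    (hAG : (resolventSet (mul A G)).Nonempty) (hGA : (resolventSet (mul G A)).Nonempty)
    {p : Polynomial ℝ} (hp : IsDefinitizing A G p) {z : ℂ} (hz : z.im ≠ 0)
    (hzs : z ∈ spectrum (mul A G)) : IsPoleOfResolvent (mul A G) z := by
  have him : ∀ᶠ μ in 𝓝[≠] z, |z.im| / 2 < |μ.im| := by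
    have h1 : Tendsto (fun μ : ℂ => |μ.im|) (𝓝 z) (𝓝 |z.im|) :=
      Continuous.tendsto (by fun_prop) z
    have h2 : |z.im| / 2 < |z.im| := by
      have := abs_pos.2 hz
      linarith
    exact (h1.eventually_const_lt h2).filter_mono nhdsWithin_le_nhds
  have hnorm : ∀ᶠ μ in 𝓝[≠] z, ‖μ‖ < ‖z‖ + 1 := by
    have h1 : Tendsto (fun μ : ℂ => ‖μ‖) (𝓝 z) (𝓝 ‖z‖) := Continuous.tendsto (by fun_prop) z
    exact (h1.eventually_lt_const (by linarith)).filter_mono nhdsWithin_le_nhds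
  have hpne : ∀ᶠ μ in 𝓝[≠] z, Polynomial.aeval μ p ≠ 0 := by
    have hfin : (p.rootSet ℂ \ {z}).Finite := (p.rootSet_finite ℂ).subset Set.sdiff_subset
    have h1 : (p.rootSet ℂ \ {z})ᶜ ∈ 𝓝 z := hfin.isClosed.isOpen_compl.mem_nhds (by simp)
    filter_upwards [mem_nhdsWithin_of_mem_nhds h1, self_mem_nhdsWithin] with μ h2 h3 h4
    exact h2 ⟨Polynomial.mem_rootSet.2 ⟨hp.1, h4⟩, h3⟩
  have hres : ∀ᶠ μ in 𝓝[≠] z, μ ∈ resolventSet (mul A G) := by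
    filter_upwards [him, hpne] with μ h1 h2
    refine mem_resolventSet_of_aeval_ne_zero hA hG hAG hGA hp (fun h0 => ?_) h2
    rw [h0, abs_zero] at h1
    linarith [abs_nonneg z.im]
  obtain ⟨l, ⟨D⟩⟩ := exists_resolventData hA hG hAG hGA
  obtain ⟨c, hc, hbelow⟩ := D.exists_bounded_below hA hG hp (‖z‖ + 1)
  set δ := |z.im| / 2 with hδ
  have hδ0 : 0 < δ := by positivity
  have hbound : ∀ᶠ μ in 𝓝[≠] z,
      ‖(Polynomial.aeval μ p) ^ 2 • resolvent (mul A G) μ‖ ≤ c / δ ^ 3 := by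
    filter_upwards [him, hnorm, hres] with μ h1 h2 h3
    refine ContinuousLinearMap.opNorm_le_bound _ (by positivity) fun y => ?_
    have h4 := hbelow μ h2.le _ _ ((resolvent_spec h3).mem_graph y)
    rw [add_sub_cancel_right] at h4
    have h5 : δ ≤ ‖μ‖ := h1.le.trans (Complex.abs_im_le_norm μ)
    rw [smul_apply, norm_smul, norm_pow, div_mul_eq_mul_div, le_div_iff₀ (by positivity)]
    calc ‖Polynomial.aeval μ p‖ ^ 2 * ‖resolvent (mul A G) μ y‖ * δ ^ 3
        = δ * δ ^ 2 * (‖Polynomial.aeval μ p‖ ^ 2 * ‖resolvent (mul A G) μ y‖) := by ring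
      _ ≤ |μ.im| * ‖μ‖ ^ 2 * (‖Polynomial.aeval μ p‖ ^ 2 * ‖resolvent (mul A G) μ y‖) := by
        gcongr
      _ = |μ.im| * ‖μ * Polynomial.aeval μ p‖ ^ 2 * ‖resolvent (mul A G) μ y‖ := by
        rw [norm_mul]
        ring
      _ ≤ c * ‖y‖ := h4
  have hdiff : Differentiable ℂ fun μ : ℂ => (Polynomial.aeval μ p) ^ 2 :=
    p.differentiable_aeval.pow 2
  have hmero1 : MeromorphicAt (fun μ => (Polynomial.aeval μ p) ^ 2 • resolvent (mul A G) μ) z := by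
    refine meromorphicAt_of_eventually_norm_le ?_ hbound
    filter_upwards [hres] with μ h1
    exact (hdiff μ).smul (differentiableAt_resolvent h1)
  have hmero : MeromorphicAt (resolvent (mul A G)) z := by
    refine ((hdiff.analyticAt z).meromorphicAt.inv.smul hmero1).congr ?_
    filter_upwards [hpne] with μ h1
    simp only [Pi.smul_apply', Pi.inv_apply]
    exact inv_smul_smul₀ (pow_ne_zero 2 h1) _
  refine ⟨hres, hmero, ?_⟩
  by_contra hord
  obtain ⟨L, hL⟩ := tendsto_nhds_of_meromorphicOrderAt_nonneg hmero (not_lt.1 hord)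
  have h1 : ∀ᶠ μ in 𝓝[≠] z, ‖resolvent (mul A G) μ‖ < ‖L‖ + 1 :=
    hL.norm.eventually_lt_const (by linarith)
  exact hzs (mem_resolventSet_of_bounded (M := ‖L‖ + 1)
    (hres.and (h1.mono fun μ h => h.le)))

end NonrealSpectrum

/-! ### Sign types of real spectral points -/

section SignTypes

variable {H : Type*} [NormedAddCommGroup H] [InnerProductSpace ℂ H]

theorem exists_bounded_below_of_notMem_approxPointSpectrum {T : H →ₗ.[ℂ] H} {z : ℂ}
    (hz : z ∉ approxPointSpectrum T) :
    ∃ c : ℝ, ∀ x x', (x, x') ∈ T.graph → ‖x‖ ≤ c * ‖x' - z • x‖ := by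
  by_contra! hcon
  refine hz ?_
  choose x x' hx hlt using fun n : ℕ => hcon ((n : ℝ) + 1)
  have hpos : ∀ n, 0 < ‖x n‖ := fun n => lt_of_le_of_lt (by positivity) (hlt n)
  have hu : ∀ n, (((‖x n‖⁻¹ : ℝ) : ℂ) • x n, ((‖x n‖⁻¹ : ℝ) : ℂ) • x' n) ∈ T.graph :=
    fun n => T.graph.smul_mem _ (hx n)
  choose u hu1 hu2 using fun n => (LinearPMap.mem_graph_iff T).1 (hu n)
  refine ⟨u, fun n => ?_, ?_⟩
  · simp only [hu1, norm_smul, Complex.norm_real, norm_inv, norm_norm]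
    exact inv_mul_cancel₀ (hpos n).ne'
  · refine squeeze_zero_norm (fun n => ?_) tendsto_one_div_add_atTop_nhds_zero_nat
    simp only [hu1, hu2]
    rw [smul_comm z, ← smul_sub, norm_smul, Complex.norm_real, norm_inv, norm_norm,
      inv_mul_le_iff₀ (hpos n), mul_one_div, le_div_iff₀ (by positivity), mul_comm]
    exact (hlt n).le

theorem abs_re_bracket_le {G₀ : H →L[ℂ] H} {x : H} (hx : ‖x‖ = 1) :
    |(bracket G₀ x x).re| ≤ ‖G₀‖ := by
  refine (Complex.abs_re_le_norm _).trans ((norm_inner_le_norm _ _).trans ?_)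
  simpa [hx] using G₀.le_opNorm x

variable [CompleteSpace H] {A G : H →ₗ.[ℂ] H}

/-- The bounded operator `G (AG - l)⁻¹ (AG - l̄)⁻¹`. -/
noncomputable def ResolventData.gram {l : ℂ} (D : ResolventData A G l) : H →L[ℂ] H := D.CR * D.S

theorem ResolventData.adjoint_CR {l : ℂ} (D : ResolventData A G l) :
    ContinuousLinearMap.adjoint D.CR = D.CS := by
  rw [← D.adjoint_CS, ContinuousLinearMap.adjoint_adjoint]

theorem ResolventData.isSelfAdjoint_gram {l : ℂ} (D : ResolventData A G l) :
    IsSelfAdjoint D.gram := by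
  rw [IsSelfAdjoint, gram, star_mul, ContinuousLinearMap.star_eq_adjoint,
    ContinuousLinearMap.star_eq_adjoint, D.adjoint_CR, D.adjoint_S_mul_CS]

/-- The inner product `[x, y]` is `(S x, G S y)`, with `S = (AG - l̄)⁻¹`. -/
theorem ResolventData.bracket_gram {l : ℂ} (D : ResolventData A G l) (x y : H) :
    bracket D.gram x y = inner ℂ (D.CS y) (D.S x) := by
  rw [bracket, gram, mul_apply_eq_comp, ← ContinuousLinearMap.adjoint_inner_left, D.adjoint_CR]

theorem ResolventData.bracket_gram' {l : ℂ} (D : ResolventData A G l) (x y : H) :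
    bracket D.gram x y = inner ℂ (D.S y) (D.CS x) := by
  rw [bracket, gram, ← D.adjoint_S_mul_CS, mul_apply_eq_comp,
    ContinuousLinearMap.adjoint_inner_right]

theorem ResolventData.isGramOperator {l : ℂ} (D : ResolventData A G l) :
    IsGramOperator A G l D.gram := by
  refine ⟨⟨_, D.isResolventAt_R⟩, ⟨_, D.isResolventAt_S⟩, D.isSelfAdjoint_gram, fun x => ?_⟩
  rw [D.isResolventAt_R.resolvent_eq, D.isResolventAt_S.resolvent_eq]
  exact (LinearPMap.mem_graph_iff G).1 (D.mem_graph_CR (D.S x))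

theorem ResolventData.isBracketSymmetric (hA : IsSelfAdjoint A) (hG : IsSelfAdjoint G)
    (hGA : (resolventSet (mul G A)).Nonempty) {l : ℂ} (hl : l ≠ 0) (D : ResolventData A G l) :
    IsBracketSymmetric D.gram (mul A G) := by
  have hlm : l ∈ resolventSet (mul A G) := ⟨_, D.isResolventAt_R⟩
  refine ⟨D.isResolventAt_R.isClosed,
    dense_domain_mul hA hG hlm (mem_resolventSet_mul_swap hGA hl hlm), fun x y => ?_⟩
  have hS : ∀ x : (mul A G).domain, D.S (mul A G x) = (1 + star l • D.S) x := by
    intro x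
    have h1 := D.isResolventAt_S.apply_eq ((mul A G).mem_graph x)
    rw [map_sub, map_smul, sub_eq_iff_eq_add] at h1
    rw [h1, add_apply, one_apply_eq_self, smul_apply]
  rw [D.bracket_gram, D.bracket_gram', hS, hS]
  exact (inner_eq_of_isSelfAdjoint hA (D.mem_graph_one_add y) (D.mem_graph_one_add x)).symm

/-- At a real point `t ≠ 0` with `p(t) ≠ 0`, the form `p(t) [·,·]` is positive definite up to the
defect `S (AG - t) x`. -/
theorem ResolventData.exists_mul_norm_sq_le_bracket {l : ℂ} (hl : l.im ≠ 0)
    (D : ResolventData A G l) {p : Polynomial ℝ} (hp : IsDefinitizing A G p) {t : ℝ}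
    (ht : t ≠ 0) (hpt : p.eval t ≠ 0) :
    ∃ δ c C : ℝ, 0 < δ ∧ 0 < c ∧ 0 ≤ C ∧ ∀ x : H,
      δ * ‖x‖ ^ 2 ≤ c * (p.eval t * (bracket D.gram x x).re) +
        C * (‖x - ((t : ℂ) - star l) • D.S x‖ * ‖x‖) := by
  set d := p.natDegree with hd
  obtain ⟨c, c', hc, hc', h⟩ := D.exists_norm_sq_le hp ‖(t : ℂ)‖
  obtain ⟨b, hb, hbS⟩ := exists_norm_sub_smul_pow_le l D.S ‖(t : ℂ)‖ d
  have haev : Polynomial.aeval (t : ℂ) p = ((p.eval t : ℝ) : ℂ) := by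
    simpa using Polynomial.aeval_algebraMap_apply ℂ t p
  set k : ℂ := ((t : ℂ) - star l) ^ d with hk
  have hk0 : k ≠ 0 := by
    refine pow_ne_zero _ fun h0 => hl ?_
    have := congrArg Complex.im h0
    simpa using this
  set m : ℝ := b * ‖D.gram‖ * (1 + ‖k‖ * ‖D.S ^ d‖) with hm
  refine ⟨‖k‖ ^ 2 * ‖(t : ℂ) * ((p.eval t : ℝ) : ℂ)‖ ^ 2, c, c * |p.eval t| * m + ‖k‖ ^ 2 * c',
    ?_, hc, by positivity, fun x => ?_⟩
  · have : (t : ℂ) * ((p.eval t : ℝ) : ℂ) ≠ 0 :=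
      mul_ne_zero (Complex.ofReal_ne_zero.2 ht) (Complex.ofReal_ne_zero.2 hpt)
    positivity
  set γ := ‖x - ((t : ℂ) - star l) • D.S x‖ with hγ
  set w := (D.S ^ d) x with hw
  have h1 := h t le_rfl x
  rw [haev, ← D.bracket_gram, Complex.re_ofReal_mul] at h1
  have h2 : ‖x - k • w‖ ≤ b * γ := hbS t le_rfl x
  have h3 : (bracket D.gram x x).re - ‖k‖ ^ 2 * (bracket D.gram w w).re =
      (inner ℂ (x - k • w) (D.gram x) + inner ℂ (k • w) (D.gram (x - k • w))).re := by
    have : bracket D.gram x x - ((‖k‖ ^ 2 : ℝ) : ℂ) * bracket D.gram w w =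
        inner ℂ (x - k • w) (D.gram x) + inner ℂ (k • w) (D.gram (x - k • w)) := by
      simp only [bracket, map_sub, map_smul, inner_sub_left, inner_sub_right, inner_smul_left,
        inner_smul_right, Complex.ofReal_pow, ← Complex.conj_mul']
      ring
    rw [← this, Complex.sub_re, Complex.re_ofReal_mul]
  have h4 : |(bracket D.gram x x).re - ‖k‖ ^ 2 * (bracket D.gram w w).re| ≤ m * (γ * ‖x‖) := by
    rw [h3]
    refine (Complex.abs_re_le_norm _).trans ((norm_add_le_of_le
      (r₁ := b * γ * (‖D.gram‖ * ‖x‖)) (r₂ := ‖k‖ * (‖D.S ^ d‖ * ‖x‖) * (‖D.gram‖ * (b * γ)))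
      ?_ ?_).trans (le_of_eq (by rw [hm]; ring)))
    · exact (norm_inner_le_norm _ _).trans
        (mul_le_mul h2 (D.gram.le_opNorm x) (norm_nonneg _) (by positivity))
    · refine (norm_inner_le_norm _ _).trans (mul_le_mul ?_ ?_ (norm_nonneg _) (by positivity))
      · rw [norm_smul]
        exact mul_le_mul_of_nonneg_left ((D.S ^ d).le_opNorm x) (norm_nonneg k)
      · exact (D.gram.le_opNorm _).trans (mul_le_mul_of_nonneg_left h2 (norm_nonneg _))
  have h5 : p.eval t * (‖k‖ ^ 2 * (bracket D.gram w w).re) ≤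
      p.eval t * (bracket D.gram x x).re + |p.eval t| * (m * (γ * ‖x‖)) := by
    have h6 := mul_le_mul_of_nonneg_left h4 (abs_nonneg (p.eval t))
    rw [← abs_mul] at h6
    have := neg_abs_le (p.eval t * ((bracket D.gram x x).re - ‖k‖ ^ 2 * (bracket D.gram w w).re))
    linarith
  calc _ = ‖k‖ ^ 2 * (‖(t : ℂ) * ((p.eval t : ℝ) : ℂ)‖ ^ 2 * ‖x‖ ^ 2) := by ring
    _ ≤ ‖k‖ ^ 2 * (c * (p.eval t * (bracket D.gram w w).re) + c' * (γ * ‖x‖)) := by gcongr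
    _ = c * (p.eval t * (‖k‖ ^ 2 * (bracket D.gram w w).re)) +
        ‖k‖ ^ 2 * (c' * (γ * ‖x‖)) := by ring
    _ ≤ c * (p.eval t * (bracket D.gram x x).re + |p.eval t| * (m * (γ * ‖x‖))) +
        ‖k‖ ^ 2 * (c' * (γ * ‖x‖)) := by gcongr
    _ = _ := by ring

/-- Along an approximate eigensequence the defect vanishes, so the definite form stays bounded away
from zero. -/
theorem ResolventData.exists_pos_le_eval_mul_bracket {l : ℂ} (hl : l.im ≠ 0)
    (D : ResolventData A G l) {p : Polynomial ℝ} (hp : IsDefinitizing A G p) {t : ℝ}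
    (ht : t ≠ 0) (hpt : p.eval t ≠ 0) {x : ℕ → (mul A G).domain}
    (hx : IsApproxEigenseq (mul A G) t x) :
    ∃ ε : ℝ, 0 < ε ∧ ∀ᶠ n in atTop, ε ≤ p.eval t * (bracket D.gram (x n) (x n)).re := by
  obtain ⟨δ, c, C, hδ, hc, hC, h⟩ := D.exists_mul_norm_sq_le_bracket hl hp ht hpt
  refine ⟨δ / (2 * c), by positivity, ?_⟩
  have h1 : Tendsto (fun n => C * ‖D.S (mul A G (x n) - (t : ℂ) • (x n : H))‖) atTop (𝓝 0) := by
    have : Tendsto (fun n => C * ‖D.S (mul A G (x n) - (t : ℂ) • (x n : H))‖) atTop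
        (𝓝 (C * ‖D.S 0‖)) :=
      ((D.S.continuous.tendsto 0).comp hx.2).norm.const_mul C
    simpa using this
  filter_upwards [h1.eventually_lt_const (half_pos hδ)] with n hn
  have h2 := h (x n)
  rw [D.isResolventAt_S.sub_smul_eq ((mul A G).mem_graph (x n)), hx.1 n] at h2
  rw [div_le_iff₀ (by positivity)]
  linarith

/-- A real point `t ≠ 0` of the spectrum is an approximate eigenvalue: the alternative is that
`AG - t` is bounded below, which by `t = t̄` excludes `t` from the spectrum. -/
theorem mem_approxPointSpectrum_of_mem_spectrum (hA : IsSelfAdjoint A) (hG : IsSelfAdjoint G)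
    (hAG : (resolventSet (mul A G)).Nonempty) (hGA : (resolventSet (mul G A)).Nonempty)
    {t : ℝ} (ht : t ≠ 0) (hts : (t : ℂ) ∈ spectrum (mul A G)) :
    (t : ℂ) ∈ approxPointSpectrum (mul A G) := by
  by_contra hcon
  obtain ⟨c, hc⟩ := exists_bounded_below_of_notMem_approxPointSpectrum hcon
  refine hts (mem_resolventSet_of_bounded_below hA hG hAG hGA (Complex.ofReal_ne_zero.2 ht) hc
    fun y hy => ?_)
  rw [Complex.star_def, Complex.conj_ofReal] at hy
  simpa using hc _ _ hy

end SignTypes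

end OpPair

theorem theorem4p3 {H : Type*} [NormedAddCommGroup H] [InnerProductSpace ℂ H] [CompleteSpace H]
    (A G : H →ₗ.[ℂ] H) (hAG : OpPair.IsDefinitizable A G) :
    -- the non-real spectrum
    (OpPair.spectrum (OpPair.mul A G) ∩ {z : ℂ | z.im ≠ 0}).Finite ∧
    (∀ z ∈ OpPair.spectrum (OpPair.mul A G), z.im ≠ 0 →
      OpPair.IsPoleOfResolvent (OpPair.mul A G) z ∧
      ∀ p : Polynomial ℝ, OpPair.IsDefinitizing A G p → Polynomial.aeval z p = 0) ∧
    -- sign types of the non-zero real spectrum, for every admissible choice of the point `z₀`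
    -- in the definition of the inner product
    (∀ z₀ ∈ OpPair.resolventSet (OpPair.mul A G), z₀.im ≠ 0 →
      ∃ G₀ : H →L[ℂ] H, OpPair.IsGramOperator A G z₀ G₀ ∧
        OpPair.IsBracketSymmetric G₀ (OpPair.mul A G) ∧
        ∀ p : Polynomial ℝ, OpPair.IsDefinitizing A G p →
          ∀ t : ℝ, (t : ℂ) ∈ OpPair.spectrum (OpPair.mul A G) → t ≠ 0 →
            (0 < p.eval t → (t : ℂ) ∈ OpPair.posType G₀ (OpPair.mul A G)) ∧
            (p.eval t < 0 → (t : ℂ) ∈ OpPair.negType G₀ (OpPair.mul A G))) := by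
  obtain ⟨hA, hG, hAG, hGA, p₀, hp₀⟩ := hAG
  have hzero : ∀ z ∈ OpPair.spectrum (OpPair.mul A G), z.im ≠ 0 →
      ∀ p : Polynomial ℝ, OpPair.IsDefinitizing A G p → Polynomial.aeval z p = 0 := by
    intro z hz him p hp
    by_contra h0
    exact hz (OpPair.mem_resolventSet_of_aeval_ne_zero hA hG hAG hGA hp him h0)
  refine ⟨(p₀.rootSet_finite ℂ).subset fun z hz => ?_, fun z hz him => ⟨?_, hzero z hz him⟩, ?_⟩
  · exact Polynomial.mem_rootSet.2 ⟨hp₀.1, hzero z hz.1 hz.2 p₀ hp₀⟩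
  · exact OpPair.isPoleOfResolvent_of_im_ne_zero hA hG hAG hGA hp₀ him hz
  intro l hl him
  have hl0 : l ≠ 0 := fun h => him (by simp [h])
  obtain ⟨D⟩ := OpPair.nonempty_resolventData hA hG hAG hGA hl0 hl
  refine ⟨D.gram, D.isGramOperator, D.isBracketSymmetric hA hG hGA hl0, fun p hp t hts ht => ?_⟩
  have happ := OpPair.mem_approxPointSpectrum_of_mem_spectrum hA hG hAG hGA ht hts
  refine ⟨fun hpt => ⟨happ, fun x hx => ?_⟩, fun hpt => ⟨happ, fun x hx => ?_⟩⟩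
  · obtain ⟨ε, hε, hev⟩ := D.exists_pos_le_eval_mul_bracket him hp ht hpt.ne' hx
    refine (div_pos hε hpt).trans_le (le_liminf_of_le ?_ ?_)
    · exact (isBoundedUnder_of ⟨‖D.gram‖, fun n =>
        (le_abs_self _).trans (OpPair.abs_re_bracket_le (hx.1 n))⟩).isCoboundedUnder_ge
    · filter_upwards [hev] with n hn
      rwa [div_le_iff₀' hpt]
  · obtain ⟨ε, hε, hev⟩ := D.exists_pos_le_eval_mul_bracket him hp ht hpt.ne hx
    refine (limsup_le_of_le ?_ ?_).trans_lt (div_neg_of_pos_of_neg hε hpt)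
    · exact (isBoundedUnder_of ⟨-‖D.gram‖, fun n =>
        (abs_le.1 (OpPair.abs_re_bracket_le (hx.1 n))).1⟩).isCoboundedUnder_le
    · filter_upwards [hev] with n hn
      rwa [le_div_iff_of_neg' hpt]
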